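/- Let $p\ge 5$ be a prime and let $\mathbb{F}_p$ be the field of order $p$. Let $\mathsf{W}(3,p)$ be the symplectic generalised quadrangle whose points and lines are the one- and two-dimensional totally isotropic subspaces of $\mathbb{F}_p^4$ with respect to the alternating form $\beta(x,y)=x_1y_4-y_1x_4+x_2y_3-y_2x_3$, with inclusion as incidence. For a set $S$ of points let $S^\perp$ be the set of points collinear with every element of $S$ (each point is collinear with itself). For a point $\mathbf{x}$ let $\mathcal{Q}^x$ be the Payne derived quadrangle: its points are the points of $\mathsf{W}(3,p)$ not collinear with $\mathbf{x}$, and its lines are the lines of $\mathsf{W}(3,p)$ not incident with $\mathbf{x}$ together with the hyperbolic lines $\{\mathbf{x},\mathbf{y}\}^{\perp\perp}$, where $\mathbf{y}$ is not collinear with $\mathbf{x}$; incidence is the inherited one. For $a,b,c,\alpha\in\mathbb{F}_p$ let $$t_{a,b,c}=\begin{pmatrix}1&0&0&0\\-c&1&0&0\\b&0&1&0\\a&b&c&1\end{pmatrix},\qquad \theta_\alpha=\begin{pmatrix}1&0&0&0\\-\alpha&1&0&0\\-\alpha^2&\alpha&1&0\\0&0&\alpha&1\end{pmatrix}$$ in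 $\mathrm{GL}(4,p)$, and let $E=\{t_{a,b,c}\mid a,b,c\in\mathbb{F}_p\}$ and $P=\langle \{t_{a,b,0}\mid a,b\in\mathbb{F}_p\}\cup\{\theta_\alpha\}\rangle$, where $\alpha\in\mathbb{F}_p$ is any nonzero element. Then $E$ is an extraspecial group (that is, a $p$-group whose centre, derived subgroup and Frattini subgroup coincide and have order $p$) of order $p^3$ and exponent $p$, and $E\cong P$. Moreover, for every point $\mathbf{x}$ of $\mathsf{W}(3,p)$, if a group $G$ acts on $\mathcal{Q}^x$ by automorphisms (incidence-preserving permutations of the points and the lines) and acts regularly on the points of $\mathcal{Q}^x$ (transitively, with only the identity of $G$ fixing a point), then $G\cong E\cong P$. -/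

import Mathlib

namespace PayneGQ

/-- A point-line incidence geometry. -/
structure Geometry where
  Point : Type*
  Line : Type*
  Inc : Point → Line → Prop

namespace Geometry

/-- Two (possibly equal) points are collinear if some line is incident with both. -/
def Collinear (Q : Geometry) (y z : Q.Point) : Prop :=
  ∃ l : Q.Line, Q.Inc y l ∧ Q.Inc z l

/-- `S^⊥`: the set of all points collinear with every element of `S`. -/
def perp (Q : Geometry) (S : Set Q.Point) : Set Q.Point :=
  {y | ∀ z ∈ S, Q.Collinear y z}

/-- Payne derivation of `Q` at the point `x`. The points are the points of `Q` not collinear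
with `x`. The lines are (i) the lines of `Q` not incident with `x`, and (ii) the hyperbolic lines
`{x, y}^⊥⊥`, where `y` is not collinear with `x`. Incidence is inherited. -/
def payne (Q : Geometry) (x : Q.Point) : Geometry where
  Point := {y : Q.Point // ¬ Q.Collinear x y}
  Line := {l : Q.Line // ¬ Q.Inc x l} ⊕
    {H : Set Q.Point // ∃ y, ¬ Q.Collinear x y ∧ H = Q.perp (Q.perp {x, y})}
  Inc y l := match l with
    | Sum.inl m => Q.Inc y.1 m.1
    | Sum.inr H => y.1 ∈ H.1

/-- The automorphism group: pairs of a permutation of the points and a permutation of the lines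
that preserve incidence and non-incidence. -/
def aut (Q : Geometry) : Subgroup (Equiv.Perm Q.Point × Equiv.Perm Q.Line) where
  carrier := {g | ∀ y l, Q.Inc (g.1 y) (g.2 l) ↔ Q.Inc y l}
  one_mem' := fun _ _ => Iff.rfl
  mul_mem' := fun {g h} hg hh y l => (hg (h.1 y) (h.2 l)).trans (hh y l)
  inv_mem' := fun {g} hg y l => by
    have h := hg (g.1⁻¹ y) (g.2⁻¹ l)
    simpa using h.symm

/-- A group `G`, acting on `Q` by automorphisms through `φ`, acts regularly on the points: it is
transitive on points and only the identity of `G` fixes a point. -/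
def ActsRegularlyOnPoints (Q : Geometry) {G : Type*} [Group G] (φ : G →* Q.aut) : Prop :=
  (∀ y z : Q.Point, ∃ g : G, (φ g).1.1 y = z) ∧
    ∀ (g : G) (y : Q.Point), (φ g).1.1 y = y → g = 1

end Geometry

section Symplectic

variable (F : Type*) [Field F]

/-- The alternating form `x₁y₄ - y₁x₄ + x₂y₃ - y₂x₃` on `F⁴`. -/
def form (u v : Fin 4 → F) : F :=
  u 0 * v 3 - v 0 * u 3 + u 1 * v 2 - v 1 * u 2

/-- The symplectic quadrangle `W(3, F)`: its points and lines are the totally isotropic subspaces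
of `F⁴` of dimension one and two, with inclusion as incidence. As the form is alternating, every
one-dimensional subspace is totally isotropic, so the points are all points of the projective
space. -/
def W3 : Geometry where
  Point := Projectivization F (Fin 4 → F)
  Line := {l : Submodule F (Fin 4 → F) //
    Module.finrank F l = 2 ∧ ∀ u ∈ l, ∀ v ∈ l, form F u v = 0}
  Inc y l := y.submodule ≤ l.1

end Symplectic

section Groups

variable {F : Type*} [Field F]

/-- The matrix `t_{a,b,c}`, as an element of `GL(4, F)`. -/
def t (a b c : F) : GL (Fin 4) F where
  val := !![1, 0, 0, 0; -c, 1, 0, 0; b, 0, 1, 0; a, b, c, 1]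
  inv := !![1, 0, 0, 0; c, 1, 0, 0; -b, 0, 1, 0; -a, -b, -c, 1]
  val_inv := by
    ext i j
    fin_cases i <;> fin_cases j <;> simp [Matrix.mul_apply, Fin.sum_univ_four] <;> ring
  inv_val := by
    ext i j
    fin_cases i <;> fin_cases j <;> simp [Matrix.mul_apply, Fin.sum_univ_four] <;> ring

/-- The matrix `θ_α`, as an element of `GL(4, F)`. -/
def theta (α : F) : GL (Fin 4) F where
  val := !![1, 0, 0, 0; -α, 1, 0, 0; -α ^ 2, α, 1, 0; 0, 0, α, 1]
  inv := !![1, 0, 0, 0; α, 1, 0, 0; 0, -α, 1, 0; 0, α ^ 2, -α, 1]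
  val_inv := by
    ext i j
    fin_cases i <;> fin_cases j <;> simp [Matrix.mul_apply, Fin.sum_univ_four] <;> ring
  inv_val := by
    ext i j
    fin_cases i <;> fin_cases j <;> simp [Matrix.mul_apply, Fin.sum_univ_four] <;> ring

theorem t_mul_t (a b c x y z : F) :
    t a b c * t x y z = t (a + x - b * z + c * y) (b + y) (c + z) := by
  ext i j
  fin_cases i <;> fin_cases j <;>
    simp [t, Matrix.mul_apply, Fin.sum_univ_four] <;> ring

theorem t_zero : t (0 : F) 0 0 = 1 := by
  ext i j
  fin_cases i <;> fin_cases j <;> simp [t]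

variable (F) in
/-- The group `E = {t_{a,b,c} | a, b, c ∈ F}`. -/
def E : Subgroup (GL (Fin 4) F) where
  carrier := {g | ∃ a b c : F, g = t a b c}
  one_mem' := ⟨0, 0, 0, t_zero.symm⟩
  mul_mem' := by
    rintro _ _ ⟨a, b, c, rfl⟩ ⟨x, y, z, rfl⟩
    exact ⟨_, _, _, t_mul_t a b c x y z⟩
  inv_mem' := by
    rintro _ ⟨a, b, c, rfl⟩
    refine ⟨-a, -b, -c, inv_eq_of_mul_eq_one_right ?_⟩
    rw [t_mul_t, ← t_zero]
    congr 1 <;> ring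

/-- The group `P = ⟨R, θ_α⟩`, where `R = {t_{a,b,0} | a, b ∈ F}`. Over a prime field `F`, the
families that form a basis of `F` over its prime field are the one-element families `{α}` with
`α ≠ 0`. -/
def P (α : F) : Subgroup (GL (Fin 4) F) :=
  Subgroup.closure ({g | ∃ a b : F, g = t a b 0} ∪ {theta α})

end Groups

/-- A finite `p`-group is extraspecial if its centre, its derived subgroup and its Frattini
subgroup coincide and have order `p`. -/
def IsExtraspecial (p : ℕ) (G : Type*) [Group G] : Prop :=
  Finite G ∧ IsPGroup p G ∧ Subgroup.center G = commutator G ∧ commutator G = frattini G ∧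
    Nat.card (Subgroup.center G) = p

end PayneGQ

/-!
The proof works in coordinates. A symplectic basis whose first vector spans `x` identifies the
points of the Payne derived quadrangle at `x` with `F × F²`, where `F = ZMod p`, in such a way that
`(a, v)` and `(a', v')` are collinear if and only if `v = v'` (hyperbolic lines through `x`) or
`a - a' = wedge v' v` (totally isotropic lines); see `exists_payneEquiv`. A group that acts by
automorphisms of the quadrangle acts by automorphisms of this graph.

The heart of the matter is that every automorphism `σ` of the graph is affine.

* The relation `v = v'` can be expressed by adjacency alone (`exceptional_iff`). For noncollinear
  points `y`, `z` over different points of the plane, the `p + 2` common neighbours are two points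
  joined to `y` or `z` by a hyperbolic line, and `p` further ones which have many common neighbours;
  no quadruple of common neighbours that contains one of the two exceptional points has a centre
  besides `y` and `z`. This uses that `2` and `3` are not zero in `F`.
* So `σ` permutes the points of the plane `F²`. Three points of the plane are collinear if and only
  if they lift to pairwise adjacent points, so the permutation is a collineation, and therefore
  additive up to a translation (`map_add_of_collineation`). Over a prime field it is affine. The
  action of `σ` on the first coordinate is then determined up to a constant (`exists_affine`).

A group `G` acting regularly has order `p³`, so its elements act as unipotent affine maps in
dimension three. A unipotent `4 × 4` matrix in characteristic `p ≥ 5` satisfies `X ^ p = 1`, so `G`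
has exponent `p`. Moreover `G` is not abelian: if `g` takes the origin to `(0, m)` with `m ≠ 0` and has
the linear part `A` on the plane, then comparing `g * h` and `h * g` at the origin, for all `h`,
forces `A m = -m`, which is impossible for `A` of odd order
(`nonempty_mulEquiv_e_of_regular`). Finally, two noncommuting elements of a group, of order `p` and
with a commutator that commutes with both, generate a copy of `E` (`exists_hom_of_commute`). This
identifies with `E` every nonabelian group of order `p³` and exponent `p`, as well as the group `P`,
which is generated in this way by `t 0 1 0` and `theta α`.
-/

namespace PayneGQ

/-! ### The coordinate model of the collinearity graph -/

section Model

variable {F : Type*} [Field F]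

/-- The determinant form on the plane `F²`. -/
def wedge (u v : F × F) : F := u.1 * v.2 - u.2 * v.1

/-- Collinearity of points of the Payne derived quadrangle in coordinates: `(a, v)` stands for the
point `⟨(a, v₁, v₂, 1)⟩`, the derivation being at `⟨(1, 0, 0, 0)⟩`. The first alternative says that
the two points are on one hyperbolic line through the latter, the second that they are
orthogonal. Every point is adjacent to itself. -/
def Adj (y z : F × F × F) : Prop := y.2 = z.2 ∨ y.1 - z.1 = wedge z.2 y.2

theorem wedge_self (u : F × F) : wedge u u = 0 := by simp only [wedge]; ring

theorem wedge_add_left (u v w : F × F) : wedge (u + v) w = wedge u w + wedge v w := by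
  simp only [wedge, Prod.fst_add, Prod.snd_add]; ring

theorem wedge_add_right (u v w : F × F) : wedge u (v + w) = wedge u v + wedge u w := by
  simp only [wedge, Prod.fst_add, Prod.snd_add]; ring

theorem wedge_sub_left (u v w : F × F) : wedge (u - v) w = wedge u w - wedge v w := by
  simp only [wedge, Prod.fst_sub, Prod.snd_sub]; ring

theorem wedge_sub_right (u v w : F × F) : wedge u (v - w) = wedge u v - wedge u w := by
  simp only [wedge, Prod.fst_sub, Prod.snd_sub]; ring

theorem wedge_swap (u v : F × F) : wedge u v = -wedge v u := by
  simp only [wedge]; ring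

theorem wedge_zero_right (v : F × F) : wedge v 0 = 0 := by simp [wedge]

theorem wedge_smul_right (c : F) (u v : F × F) : wedge u (c • v) = c * wedge u v := by
  simp only [wedge, Prod.smul_fst, Prod.smul_snd, smul_eq_mul]; ring

theorem wedge_smul_left (c : F) (u v : F × F) : wedge (c • u) v = c * wedge u v := by
  simp only [wedge, Prod.smul_fst, Prod.smul_snd, smul_eq_mul]; ring

theorem exists_wedge_eq {u : F × F} (hu : u ≠ 0) (c : F) : ∃ v, wedge u v = c := by
  by_cases h : u.1 = 0
  · have h2 : u.2 ≠ 0 := fun h2 => hu (Prod.ext h h2)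
    exact ⟨(-c / u.2, 0), by simp only [wedge]; field_simp; ring⟩
  · exact ⟨(0, c / u.1), by simp only [wedge]; field_simp; ring⟩

/-- Expansion of a vector in the basis `u, v`, cleared of denominators. -/
theorem wedge_expand (u v w : F × F) :
    wedge u v • w = wedge w v • u + wedge u w • v := by
  ext <;> simp only [wedge, Prod.smul_fst, Prod.smul_snd, Prod.fst_add, Prod.snd_add,
    smul_eq_mul] <;> ring

theorem eq_zero_of_wedge {u v d : F × F} (h : wedge u v ≠ 0) (hu : wedge d u = 0)
    (hv : wedge d v = 0) : d = 0 := by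
  have := wedge_expand u v d
  rw [hv, wedge_swap u d, hu] at this
  simpa [h] using this

/-- Parallelism of nonzero vectors is transitive. -/
theorem wedge_eq_zero_trans {u v w : F × F} (hv : v ≠ 0) (h1 : wedge u v = 0)
    (h2 : wedge v w = 0) : wedge u w = 0 := by
  by_contra h
  exact hv (eq_zero_of_wedge h (by rw [wedge_swap, h1, neg_zero]) h2)

theorem Adj.symm {y z : F × F × F} (h : Adj y z) : Adj z y := by
  rcases h with h | h
  · exact Or.inl h.symm
  · right; rw [wedge_swap, ← h]; ring

theorem Adj.sub_eq {y z : F × F × F} (h : Adj y z) (hne : y.2 ≠ z.2) :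
    y.1 - z.1 = wedge z.2 y.2 := h.resolve_left hne

/-! ### Hyperbolic lines are determined by the graph -/

/-- A relation on the vertices of the graph `Adj`, phrased by adjacency alone: `w` is adjacent to
`y`, and among the common neighbours of `y` and a further vertex `z`, the vertex `w` never belongs
to a quadruple with a centre other than `y` and `z`. -/
def Exceptional (y w : F × F × F) : Prop :=
  Adj y w ∧ ∀ z, Adj z w → ¬ Adj z y → ¬ ∃ w₁ w₂ w₃ k,
    (w₁ ≠ w ∧ w₂ ≠ w ∧ w₃ ≠ w ∧ w₁ ≠ w₂ ∧ w₁ ≠ w₃ ∧ w₂ ≠ w₃) ∧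
    (Adj w₁ y ∧ Adj w₂ y ∧ Adj w₃ y) ∧ (Adj w₁ z ∧ Adj w₂ z ∧ Adj w₃ z) ∧
    k ≠ y ∧ k ≠ z ∧ Adj k w ∧ Adj k w₁ ∧ Adj k w₂ ∧ Adj k w₃

theorem Exceptional.map (σ : Equiv.Perm (F × F × F)) (hσ : ∀ y z, Adj (σ y) (σ z) ↔ Adj y z)
    {y w : F × F × F} (h : Exceptional y w) : Exceptional (σ y) (σ w) := by
  refine ⟨(hσ _ _).2 h.1, fun z hzw hzy => ?_⟩
  rintro ⟨w₁, w₂, w₃, k, hne, hy, hz, hk⟩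
  obtain ⟨z, rfl⟩ := σ.surjective z
  obtain ⟨w₁, rfl⟩ := σ.surjective w₁
  obtain ⟨w₂, rfl⟩ := σ.surjective w₂
  obtain ⟨w₃, rfl⟩ := σ.surjective w₃
  obtain ⟨k, rfl⟩ := σ.surjective k
  simp only [hσ, ne_eq, EmbeddingLike.apply_eq_iff_eq] at *
  exact h.2 z hzw hzy ⟨w₁, w₂, w₃, k, hne, hy, hz, hk⟩

theorem exceptional_map_iff (σ : Equiv.Perm (F × F × F))
    (hσ : ∀ y z, Adj (σ y) (σ z) ↔ Adj y z) (y w : F × F × F) :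
    Exceptional (σ y) (σ w) ↔ Exceptional y w := by
  refine ⟨fun h => ?_, Exceptional.map σ hσ⟩
  have := Exceptional.map σ⁻¹ (fun y z => by rw [← hσ]; simp) h
  simpa using this

/-- The left translations of the Heisenberg group, as permutations of the model. -/
def translation (y : F × F × F) : Equiv.Perm (F × F × F) where
  toFun z := (z.1 + y.1 + wedge y.2 z.2, z.2 + y.2)
  invFun z := (z.1 - y.1 - wedge y.2 (z.2 - y.2), z.2 - y.2)
  left_inv z := Prod.ext (by simp; ring) (by simp)
  right_inv z := Prod.ext (by simp; ring) (by simp)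

theorem adj_translation (y z w : F × F × F) :
    Adj (translation y z) (translation y w) ↔ Adj z w := by
  simp only [Adj, translation, Equiv.coe_fn_mk, add_left_inj, wedge_add_left, wedge_add_right,
    wedge_self]
  rw [wedge_swap w.2 y.2]
  refine or_congr Iff.rfl ⟨fun h => ?_, fun h => ?_⟩ <;> linear_combination h

/-- If `v₁, v₂` are distinct points of the line `wedge · v = a`, where `a ≠ 0`, then `v` is
determined by them. -/
theorem eq_of_wedge_eq {a : F} (ha : a ≠ 0) {v₁ v₂ u v : F × F} (hne : v₁ ≠ v₂)
    (h1 : wedge v₁ v = a) (h2 : wedge v₂ v = a) (h3 : wedge v₁ u = a) (h4 : wedge v₂ u = a) :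
    u = v := by
  by_contra huv
  have h5 : wedge (v₁ - v₂) v = 0 := by rw [wedge_sub_left, h1, h2, sub_self]
  have h6 : wedge (v₁ - v₂) (u - v) = 0 := by
    rw [wedge_sub_left, wedge_sub_right, wedge_sub_right, h1, h2, h3, h4]; ring
  have h7 : wedge v₁ (u - v) = 0 := by rw [wedge_sub_right, h1, h3, sub_self]
  have h8 : wedge v₁ (v₁ - v₂) = 0 :=
    wedge_eq_zero_trans (sub_ne_zero.2 huv) h7 (by rw [wedge_swap, h6, neg_zero])
  exact ha (h1 ▸ wedge_eq_zero_trans (sub_ne_zero.2 hne) h8 h5)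

theorem exceptional_zero_iff (h2 : (2 : F) ≠ 0) (h3 : (3 : F) ≠ 0) (w : F × F × F) :
    Exceptional 0 w ↔ w.2 = 0 := by
  constructor
  · rintro ⟨hw, h⟩
    by_contra hw0
    obtain ⟨w', w⟩ := w
    obtain rfl : w' = 0 := by simpa [wedge] using (hw.symm.sub_eq hw0)
    obtain ⟨v, hv⟩ := exists_wedge_eq hw0 1
    have hv0 : v ≠ 0 := by rintro rfl; simp [wedge] at hv
    simp only at hv
    -- For `z = (1, v)` the common neighbours of `0` and `z` include the points `(0, w + i • v)`,
    -- and these have the common neighbours `(c, c • v)`.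
    have hadj : ∀ i c : F, Adj (c, c • v) (0, w + i • v) := fun i c => by
      right
      simp only [wedge_add_left, wedge_smul_left, wedge_smul_right, hv, wedge_self]; ring
    have h0' : ∀ i : F, Adj 0 (0, w + i • v) := fun i => Or.inr (by simp [wedge])
    refine h (1, v) (by simpa using hadj 0 1) (by simp [Adj, hv0, wedge]) ?_
    have hinj : ∀ i j : F, i ≠ j → ((0 : F), w + i • v) ≠ (0, w + j • v) := fun i j hij he =>
      hij (smul_left_injective F hv0 (by simpa using he))
    have h0 : ∀ i : F, i ≠ 0 → ((0 : F), w + i • v) ≠ (0, w) := fun i hi => by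
      simpa using hinj i 0 hi
    refine ⟨(0, w + (1 : F) • v), (0, w + (2 : F) • v), (0, w + (3 : F) • v), (2, (2 : F) • v),
      ⟨h0 _ one_ne_zero, h0 _ h2, h0 _ h3, hinj _ _ fun h => one_ne_zero (α := F) ?_,
        hinj _ _ fun h => h2 ?_, hinj _ _ fun h => one_ne_zero (α := F) ?_⟩,
      ⟨?_, ?_, ?_⟩, ⟨?_, ?_, ?_⟩, ?_, ?_, ?_, hadj _ _, hadj _ _, hadj _ _⟩
    · linear_combination -h
    · linear_combination -h
    · linear_combination -h
    · exact (h0' _).symm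
    · exact (h0' _).symm
    · exact (h0' _).symm
    · simpa using (hadj 1 1).symm
    · simpa using (hadj 2 1).symm
    · simpa using (hadj 3 1).symm
    · intro h; exact h2 (congrArg Prod.fst h)
    · intro h; exact one_ne_zero (α := F) (by linear_combination congrArg Prod.fst h)
    · simpa using hadj 0 2
  · intro hw
    refine ⟨Or.inl hw.symm, ?_⟩
    rintro ⟨a, v⟩ hzw hz0 ⟨⟨a₁, v₁⟩, ⟨a₂, v₂⟩, ⟨a₃, v₃⟩, ⟨b, u⟩, ⟨hw1, hw2, hw3, h12, h13, h23⟩,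
      ⟨hy1, hy2, hy3⟩, ⟨hz1, hz2, hz3⟩, hky, hkz, hkw, hk1, hk2, hk3⟩
    obtain ⟨a', w⟩ := w
    obtain rfl : w = 0 := hw
    have hv : v ≠ 0 := fun h => hz0 (Or.inl h)
    obtain rfl : a = a' := by
      simpa [wedge, sub_eq_zero] using hzw.sub_eq hv
    have ha : a ≠ 0 := by
      rintro rfl; exact hz0 (Or.inr (by simp [wedge]))
    -- A common neighbour of `0` and `z` other than `w` lies over `v` or over the line
    -- `wedge · v = a`.
    have key : ∀ a₁ v₁, (a₁, v₁) ≠ (a, (0 : F × F)) → Adj (a₁, v₁) (0 : F × F × F) →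
        Adj (a₁, v₁) (a, v) → Adj (b, u) (a₁, v₁) →
        a₁ = 0 ∧ v₁ ≠ 0 ∧ (v₁ = v ∨ wedge v₁ v = a) ∧ (u = v₁ ∨ b = wedge v₁ u) := by
      intro a₁ v₁ hne h0 h1 hk
      have hv1 : v₁ ≠ 0 := by
        rintro rfl
        apply hne
        have := h1.sub_eq hv.symm
        rw [wedge_zero_right, sub_eq_zero] at this
        simp only at this
        rw [this]
      have ha1 : a₁ = 0 := by simpa [wedge] using h0.sub_eq hv1
      subst ha1
      refine ⟨rfl, hv1, h1.imp id fun h => ?_, hk.imp id fun h => by simpa using h⟩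
      rw [wedge_swap, ← h]; simp
    obtain ⟨rfl, n1, c1, d1⟩ := key _ _ hw1 hy1 hz1 hk1
    obtain ⟨rfl, n2, c2, d2⟩ := key _ _ hw2 hy2 hz2 hk2
    obtain ⟨rfl, n3, c3, d3⟩ := key _ _ hw3 hy3 hz3 hk3
    have hu : u ≠ 0 := by
      rintro rfl
      apply hky
      rcases d1 with d1 | d1
      · exact absurd d1.symm n1
      · rw [d1, wedge_zero_right]; rfl
    obtain rfl : b = a := by
      simpa [wedge, sub_eq_zero] using hkw.sub_eq hu
    have huv : u ≠ v := fun h => hkz (by rw [h])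
    have e12 : v₁ ≠ v₂ := fun h => h12 (by rw [h])
    have e13 : v₁ ≠ v₃ := fun h => h13 (by rw [h])
    have e23 : v₂ ≠ v₃ := fun h => h23 (by rw [h])
    -- The points `v` and `u` cannot both occur among the three.
    have hno : wedge u v = b → b = wedge v u → False := fun h h' => by
      rw [wedge_swap, h] at h'
      exact mul_ne_zero h2 ha (by linear_combination h')
    have hgen : ∀ v₁ v₂ : F × F, v₁ ≠ v₂ → wedge v₁ v = b → wedge v₂ v = b → b = wedge v₁ u →
        b = wedge v₂ u → False := fun v₁ v₂ hne p1 p2 q1 q2 =>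
      huv (eq_of_wedge_eq ha hne p1 p2 q1.symm q2.symm)
    clear key hk1 hk2 hk3 hz1 hz2 hz3 hy1 hy2 hy3 hw1 hw2 hw3 hkw hkz hky hzw hz0 h12 h13 h23
    grind

/-- Two points lie on one hyperbolic line if and only if they satisfy the graph-theoretic
relation `Exceptional`. -/
theorem exceptional_iff (h2 : (2 : F) ≠ 0) (h3 : (3 : F) ≠ 0) (y w : F × F × F) :
    Exceptional y w ↔ y.2 = w.2 := by
  have hy : translation y 0 = y := by ext <;> simp [translation, wedge]
  have hw := (translation y).apply_symm_apply w
  set z := (translation y).symm w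
  rw [← hw]
  have := exceptional_map_iff _ (adj_translation y) 0 z
  rw [hy] at this
  rw [this, exceptional_zero_iff h2 h3]
  simp [translation]

end Model

/-! ### Automorphisms of the graph are affine -/

section Affine

variable {F : Type*} [Field F]

/-- A collineation of the affine plane that fixes the origin is additive on independent vectors,
by the parallelogram construction of the sum. -/
theorem map_add_of_wedge_ne {f : F × F → F × F} (hf : Function.Surjective f) (h0 : f 0 = 0)
    (hcol : ∀ u v w, wedge (f v - f u) (f w - f u) = 0 ↔ wedge (v - u) (w - u) = 0)
    {v w : F × F} (hvw : wedge v w ≠ 0) : f (v + w) = f v + f w := by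
  have hcol0 : ∀ v w, wedge (f v) (f w) = 0 ↔ wedge v w = 0 := fun v w => by
    simpa [h0] using hcol 0 v w
  -- The lines through `0, w` and through `v, v + w` are disjoint, so their images are parallel.
  have par : ∀ v w : F × F, wedge v w ≠ 0 → wedge (f (v + w) - f v) (f w) = 0 := by
    intro v w hvw
    by_contra hne
    set e := f (v + w) - f v with he
    obtain ⟨q, hq⟩ := hf (f v + (-(wedge (f v) (f w)) / wedge e (f w)) • e)
    have h1 : wedge (f (v + w) - f v) (f q - f v) = 0 := by
      rw [hq, ← he, add_sub_cancel_left, wedge_smul_right, wedge_self, mul_zero]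
    have h2 : wedge (f q) (f w) = 0 := by
      rw [hq, wedge_add_left, wedge_smul_left]
      field_simp
      ring
    rw [hcol, add_sub_cancel_left, wedge_sub_right] at h1
    rw [hcol0, wedge_swap, neg_eq_zero] at h2
    rw [h2, zero_sub, neg_eq_zero, wedge_swap, neg_eq_zero] at h1
    exact hvw h1
  have hwv : wedge w v ≠ 0 := by rwa [wedge_swap, neg_ne_zero]
  have p1 := par v w hvw
  have p2 := par w v hwv
  rw [add_comm w v] at p2
  rw [← sub_eq_zero]
  refine eq_zero_of_wedge (fun h => hvw ((hcol0 v w).1 h)) ?_ ?_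
  · rw [← p2]; simp only [wedge_sub_left, wedge_add_left, wedge_self]; ring
  · rw [← p1]; simp only [wedge_sub_left, wedge_add_left, wedge_self]; ring

/-- A collineation of the affine plane that fixes the origin is additive. -/
theorem map_add_of_collineation {f : F × F → F × F} (hf : Function.Surjective f) (h0 : f 0 = 0)
    (hcol : ∀ u v w, wedge (f v - f u) (f w - f u) = 0 ↔ wedge (v - u) (w - u) = 0)
    (v w : F × F) : f (v + w) = f v + f w := by
  have add := fun {v w : F × F} => map_add_of_wedge_ne hf h0 hcol (v := v) (w := w)
  by_cases hvw : wedge v w = 0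
  swap
  · exact add hvw
  by_cases hv : v = 0
  · simp [hv, h0]
  by_cases hw : w = 0
  · simp [hw, h0]
  -- For parallel vectors, add an independent vector to both sides.
  obtain ⟨u, hu⟩ := exists_wedge_eq hw (-1)
  have huw : wedge u w ≠ 0 := by rw [wedge_swap, hu]; simp
  have huv : wedge u v ≠ 0 := fun h => huw (wedge_eq_zero_trans hv h hvw)
  have e1 : f (u + v + w) = f u + f v + f w := by
    rw [add (by rwa [wedge_add_left, hvw, add_zero]), add huv]
  by_cases hs : v + w = 0
  · rw [add_assoc, hs, add_zero] at e1
    rw [hs, h0]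
    have : f u + (f v + f w) = f u := by rw [← add_assoc, ← e1]
    exact (left_eq_add.1 this.symm).symm
  · have : wedge u (v + w) ≠ 0 := fun h => huw (wedge_eq_zero_trans hs h (by
      rw [wedge_add_left, hvw, wedge_self, add_zero]))
    rw [add_assoc, add this, add_assoc] at e1
    exact add_left_cancel e1

/-- The collinearity of three points of the plane can be read off from the graph: it says that the
points lift to pairwise adjacent vertices. -/
theorem wedge_eq_zero_iff_exists_adj {u v w : F × F} (huv : u ≠ v) (huw : u ≠ w) (hvw : v ≠ w) :
    wedge (v - u) (w - u) = 0 ↔ ∃ a b c : F, Adj (a, u) (b, v) ∧ Adj (a, u) (c, w) ∧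
      Adj (b, v) (c, w) := by
  constructor
  · intro h
    refine ⟨0, wedge u v, wedge u w, Or.inr ?_, Or.inr ?_, Or.inr ?_⟩
    · simp only [wedge]; ring
    · simp only [wedge]; ring
    · simp only [wedge, Prod.fst_sub, Prod.snd_sub] at h ⊢; linear_combination h
  · rintro ⟨a, b, c, h1, h2, h3⟩
    replace h1 := h1.sub_eq huv
    replace h2 := h2.sub_eq huw
    replace h3 := h3.sub_eq hvw
    simp only [wedge, Prod.fst_sub, Prod.snd_sub] at h1 h2 h3 ⊢
    linear_combination h1 + h3 - h2

section Perm

variable {σ : Equiv.Perm (F × F × F)}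

theorem snd_apply_eq_iff (h2 : (2 : F) ≠ 0) (h3 : (3 : F) ≠ 0)
    (hσ : ∀ y z, Adj (σ y) (σ z) ↔ Adj y z) (y z : F × F × F) :
    (σ y).2 = (σ z).2 ↔ y.2 = z.2 := by
  rw [← exceptional_iff h2 h3, exceptional_map_iff σ hσ, exceptional_iff h2 h3]

theorem exists_addMonoidHom (h2 : (2 : F) ≠ 0) (h3 : (3 : F) ≠ 0)
    (hσ : ∀ y z, Adj (σ y) (σ z) ↔ Adj y z) :
    ∃ A : F × F →+ F × F, ∀ y, (σ y).2 = A y.2 + (σ 0).2 := by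
  have hfib := snd_apply_eq_iff h2 h3 hσ
  set M : F × F → F × F := fun v => (σ (0, v)).2 with hM
  have hσM : ∀ y, (σ y).2 = M y.2 := fun y => (hfib _ _).2 rfl
  have hinj : ∀ {u v}, M u = M v ↔ u = v := fun {u v} => hfib (0, u) (0, v)
  have hsurj : Function.Surjective M := fun v => by
    refine ⟨(σ.symm (0, v)).2, ?_⟩
    rw [← hσM, Equiv.apply_symm_apply]
  have hcol : ∀ u v w, wedge (M v - M u) (M w - M u) = 0 ↔ wedge (v - u) (w - u) = 0 := by
    intro u v w
    by_cases huv : u = v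
    · simp [huv, wedge]
    by_cases huw : u = w
    · simp [huw, wedge]
    by_cases hvw : v = w
    · simp [hvw, wedge_self]
    rw [wedge_eq_zero_iff_exists_adj huv huw hvw,
      wedge_eq_zero_iff_exists_adj (mt hinj.1 huv) (mt hinj.1 huw) (mt hinj.1 hvw)]
    constructor
    · rintro ⟨a, b, c, h⟩
      have lift : ∀ (a : F) (u : F × F), ∃ a', σ (a', u) = (a, M u) := fun a u => by
        refine ⟨(σ.symm (a, M u)).1, ?_⟩
        have : (σ.symm (a, M u)).2 = u := by rw [← hinj, ← hσM, Equiv.apply_symm_apply]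
        have h' : ((σ.symm (a, M u)).1, u) = σ.symm (a, M u) := Prod.ext rfl this.symm
        rw [h', Equiv.apply_symm_apply]
      obtain ⟨a', ha⟩ := lift a u
      obtain ⟨b', hb⟩ := lift b v
      obtain ⟨c', hc⟩ := lift c w
      rw [← ha, ← hb, ← hc, hσ, hσ, hσ] at h
      exact ⟨a', b', c', h⟩
    · rintro ⟨a, b, c, h⟩
      have lift : ∀ (a : F) (u : F × F), σ (a, u) = ((σ (a, u)).1, M u) := fun a u =>
        Prod.ext rfl (hσM _)
      refine ⟨(σ (a, u)).1, (σ (b, v)).1, (σ (c, w)).1, ?_⟩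
      rw [← lift, ← lift, ← lift, hσ, hσ, hσ]
      exact h
  have hadd := map_add_of_collineation (f := fun v => M v - M 0)
    (fun v => (hsurj (v + M 0)).imp fun u hu => by simp [hu]) (sub_self _)
    (fun u v w => by simpa only [sub_sub_sub_cancel_right] using hcol u v w)
  refine ⟨AddMonoidHom.mk' (fun v => M v - M 0) hadd, fun y => ?_⟩
  rw [hσM y, hσM 0]
  simp

end Perm

end Affine

section Prime

variable {p : ℕ} [Fact p.Prime]

theorem wedge_map (A : ZMod p × ZMod p →ₗ[ZMod p] ZMod p × ZMod p) (u v : ZMod p × ZMod p) :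
    wedge (A u) (A v) = wedge (A (1, 0)) (A (0, 1)) * wedge u v := by
  have h : ∀ u : ZMod p × ZMod p, A u = u.1 • A (1, 0) + u.2 • A (0, 1) := fun u => by
    rw [← map_smul, ← map_smul, ← map_add]; congr 1; ext <;> simp
  rw [h u, h v]
  simp only [wedge, Prod.fst_add, Prod.snd_add, Prod.smul_fst, Prod.smul_snd, smul_eq_mul]
  ring

/-- An automorphism of the graph over a prime field is an affine map: with `A` its linear part on
the plane and `d` the determinant of `A`, it acts on the first coordinate as
`a ↦ d * a + wedge m (A v) + k`. -/
theorem exists_affine (h2 : (2 : ZMod p) ≠ 0) (h3 : (3 : ZMod p) ≠ 0)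
    {σ : Equiv.Perm (ZMod p × ZMod p × ZMod p)}
    (hσ : ∀ y z, Adj (σ y) (σ z) ↔ Adj y z) :
    ∃ (A : ZMod p × ZMod p →ₗ[ZMod p] ZMod p × ZMod p) (d : ZMod p),
      (∀ u v, wedge (A u) (A v) = d * wedge u v) ∧
      ∀ y, σ y = (d * y.1 + wedge (σ 0).2 (A y.2) + (σ 0).1, A y.2 + (σ 0).2) := by
  obtain ⟨A₀, hA₀⟩ := exists_addMonoidHom h2 h3 hσ
  set A : ZMod p × ZMod p →ₗ[ZMod p] ZMod p × ZMod p := A₀.toZModLinearMap p with hAdef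
  have hA : ∀ y, (σ y).2 = A y.2 + (σ 0).2 := hA₀
  obtain ⟨d, hd⟩ : ∃ d, ∀ u v, wedge (A u) (A v) = d * wedge u v := ⟨_, wedge_map A⟩
  refine ⟨A, d, hd, ?_⟩
  set h : ZMod p × ZMod p × ZMod p → ZMod p := fun y =>
    (σ y).1 - d * y.1 - wedge (σ 0).2 (A y.2) with hh
  -- The function `h` takes the same value at adjacent vertices over different points of the plane.
  have step : ∀ y z, Adj y z → y.2 ≠ z.2 → h y = h z := by
    intro y z hyz hne
    have h1 := hyz.sub_eq hne
    have h2 := ((hσ y z).2 hyz).sub_eq (mt (snd_apply_eq_iff h2 h3 hσ y z).1 hne)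
    rw [hA y, hA z] at h2
    simp only [wedge_add_left, wedge_add_right, wedge_self, hd, ← h1] at h2
    rw [wedge_swap (A z.2)] at h2
    simp only [hh]
    linear_combination h2
  have hconst1 : ∀ y : ZMod p × ZMod p × ZMod p, y.2 ≠ 0 → h y = h 0 := by
    rintro ⟨a, v⟩ hv
    by_cases ha : a = 0
    · exact step _ _ (Or.inr (by simp [ha, wedge])) hv
    · obtain ⟨w, hw⟩ := exists_wedge_eq hv (-a)
      have hw0 : w ≠ 0 := by
        rintro rfl; rw [wedge_zero_right] at hw; exact ha (by simpa using hw.symm)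
      refine (step (a, v) (0, w) (Or.inr ?_) ?_).trans (step (0, w) 0 (Or.inr ?_) hw0)
      · rw [wedge_swap, hw]; simp
      · rintro (rfl : v = w)
        rw [wedge_self] at hw; exact ha (by simpa using hw.symm)
      · simp [wedge]
  have hconst : ∀ y : ZMod p × ZMod p × ZMod p, h y = h 0 := by
    rintro ⟨a, v⟩
    by_cases hv : v = 0
    · subst hv
      have hne : ((1, 0) : ZMod p × ZMod p) ≠ 0 := by simp
      exact (step (a, 0) (a, (1, 0)) (Or.inr (by simp [wedge])) hne.symm).trans (hconst1 _ hne)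
    · exact hconst1 _ hv
  intro y
  have := hconst y
  simp only [hh, Prod.fst_zero, Prod.snd_zero, map_zero, wedge_zero_right, mul_zero,
    sub_zero] at this
  exact Prod.ext (by linear_combination this) (hA y)

end Prime

/-! ### Heisenberg groups inside abstract groups -/

section Heisenberg

open scoped commutatorElement

variable {p : ℕ} [Fact p.Prime] {G : Type*} [Group G]

theorem pow_val_add {g : G} (hg : g ^ p = 1) (a b : ZMod p) :
    g ^ (a + b).val = g ^ a.val * g ^ b.val := by
  rw [ZMod.val_add, ← pow_add, ← pow_eq_pow_mod _ hg]

theorem pow_val_natCast {g : G} (hg : g ^ p = 1) (n : ℕ) : g ^ (n : ZMod p).val = g ^ n := by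
  rw [ZMod.val_natCast, ← pow_eq_pow_mod _ hg]

theorem pow_mul_pow_of_comm {x y w : G} (hx : Commute w x) (hy : Commute w y)
    (h : y * x = x * y * w) (m n : ℕ) : y ^ m * x ^ n = x ^ n * y ^ m * w ^ (m * n) := by
  have h1 : ∀ m, y ^ m * x = x * y ^ m * w ^ m := by
    intro m
    induction m with
    | zero => simp
    | succ m ih =>
      calc y ^ (m + 1) * x = y ^ m * (y * x) := by rw [pow_succ, mul_assoc]
        _ = y ^ m * x * (y * w) := by rw [h]; simp only [mul_assoc]
        _ = x * y ^ m * (w ^ m * y) * w := by rw [ih]; simp only [mul_assoc]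
        _ = x * y ^ (m + 1) * w ^ (m + 1) := by
          rw [(hy.pow_left m).eq]; simp only [pow_succ, mul_assoc]
  induction n with
  | zero => simp
  | succ n ih =>
    calc y ^ m * x ^ (n + 1) = y ^ m * x ^ n * x := by rw [pow_succ, mul_assoc]
      _ = x ^ n * y ^ m * (w ^ (m * n) * x) := by rw [ih]; simp only [mul_assoc]
      _ = x ^ n * (y ^ m * x) * w ^ (m * n) := by
        rw [(hx.pow_left _).eq]; simp only [mul_assoc]
      _ = x ^ (n + 1) * y ^ m * (w ^ m * w ^ (m * n)) := by
        rw [h1]; simp only [pow_succ, mul_assoc]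
      _ = _ := by rw [← pow_add]; congr 2; ring

theorem t_injective {F : Type*} [Field F] {a b c a' b' c' : F} :
    t a b c = t a' b' c' ↔ a = a' ∧ b = b' ∧ c = c' := by
  refine ⟨fun h => ?_, by rintro ⟨rfl, rfl, rfl⟩; rfl⟩
  have h' := congrArg (fun g : GL (Fin 4) F => g.val 3) h
  have h0 := congrFun h' 0
  have h1 := congrFun h' 1
  have h2 := congrFun h' 2
  simp only [t] at h0 h1 h2
  exact ⟨by simpa using h0, by simpa using h1, by simpa using h2⟩

/-- The elements of `E` are the matrices `t a b c`, each for one triple of parameters. -/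
noncomputable def eEquiv (F : Type*) [Field F] : F × F × F ≃ E F :=
  Equiv.ofBijective (fun y => ⟨t y.1 y.2.1 y.2.2, y.1, y.2.1, y.2.2, rfl⟩) (by
    constructor
    · rintro ⟨a, b, c⟩ ⟨a', b', c'⟩ h
      obtain ⟨rfl, rfl, rfl⟩ := t_injective.1 (congrArg Subtype.val h)
      rfl
    · rintro ⟨_, a, b, c, rfl⟩
      exact ⟨(a, b, c), rfl⟩)

theorem eEquiv_mul {F : Type*} [Field F] (y z : F × F × F) :
    eEquiv F y * eEquiv F z = eEquiv F
      (y.1 + z.1 - y.2.1 * z.2.2 + y.2.2 * z.2.1, y.2.1 + z.2.1, y.2.2 + z.2.2) :=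
  Subtype.ext (t_mul_t _ _ _ _ _ _)

theorem eEquiv_zero (F : Type*) [Field F] : eEquiv F 0 = 1 := Subtype.ext t_zero

/-- A homomorphism on `E` is injective as soon as it does not kill the centre of `E`: if it kills a
noncentral element, it kills a nontrivial commutator. -/
theorem injective_of_map_ne_one (h2 : (2 : ZMod p) ≠ 0) (f : E (ZMod p) →* G)
    (hf : f (eEquiv _ (1, 0, 0)) ≠ 1) : Function.Injective f := by
  have hc : ∀ a : ZMod p, f (eEquiv _ (a, 0, 0)) = 1 → a = 0 := by
    intro a ha
    by_contra ha0
    apply hf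
    have hpow : ∀ n : ℕ, eEquiv (ZMod p) (n * a, 0, 0) = eEquiv (ZMod p) (a, 0, 0) ^ n := by
      intro n
      induction n with
      | zero => rw [pow_zero, Nat.cast_zero, zero_mul]; exact eEquiv_zero (ZMod p)
      | succ n ih =>
        rw [pow_succ, ← ih, eEquiv_mul]
        congr 1; ext <;> simp; ring
    have := hpow (a⁻¹).val
    rw [ZMod.natCast_zmod_val, inv_mul_cancel₀ ha0] at this
    rw [this, map_pow, ha, one_pow]
  have hcomm : ∀ y z : ZMod p × ZMod p × ZMod p, eEquiv _ y * eEquiv _ z =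
      eEquiv _ (2 * (y.2.2 * z.2.1 - y.2.1 * z.2.2), 0, 0) * (eEquiv _ z * eEquiv _ y) := by
    intro y z
    rw [eEquiv_mul, eEquiv_mul, eEquiv_mul]
    congr 1; ext <;> simp <;> ring
  have hker : ∀ y z : ZMod p × ZMod p × ZMod p, f (eEquiv _ y) = 1 →
      y.2.2 * z.2.1 - y.2.1 * z.2.2 = 0 := by
    intro y z hy
    have := congrArg f (hcomm y z)
    rw [map_mul, map_mul, map_mul, hy, one_mul, mul_one, right_eq_mul] at this
    exact (mul_eq_zero.1 (hc _ this)).resolve_left h2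
  rw [injective_iff_map_eq_one]
  intro g hg
  obtain ⟨y, rfl⟩ := (eEquiv (ZMod p)).surjective g
  have h1 := hker y (0, 1, 0) hg
  have h3 := hker y (0, 0, 1) hg
  obtain ⟨a, b, c⟩ := y
  simp only [mul_one, mul_zero, sub_zero, zero_sub, neg_eq_zero] at h1 h3
  subst h1 h3
  rw [hc a hg]
  exact eEquiv_zero _

/-- Two elements of order `p` whose commutator is central in the group they generate, and
nontrivial, generate a copy of `E`. -/
theorem exists_hom_of_commute (h2 : (2 : ZMod p) ≠ 0) {x y : G} (hx : x ^ p = 1) (hy : y ^ p = 1)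
    (hne : x * y ≠ y * x) (hzx : Commute ⁅x, y⁆ x) (hzy : Commute ⁅x, y⁆ y) :
    ∃ f : E (ZMod p) →* G, Function.Injective f ∧ x ∈ f.range ∧ y ∈ f.range := by
  set z := ⁅x, y⁆ with hz
  have hxy : x * y = y * x * z := by
    rw [mul_assoc, ← hzx.eq, ← mul_assoc, ← hzy.eq, hz, commutatorElement_def]; group
  have hzp : z ^ p = 1 := by
    have := pow_mul_pow_of_comm hzy hzx hxy p 1
    rwa [hx, one_mul, mul_one, mul_one, pow_one, left_eq_mul] at this
  have hz1 : z ≠ 1 := fun h => hne (by rw [hxy, h, mul_one])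
  -- The element `w` plays the role of `t 1 0 0`, and `z` is `w⁻²`.
  set w := z ^ (-2⁻¹ : ZMod p).val with hw
  have hwx : Commute w x := hzx.pow_left _
  have hwy : Commute w y := hzy.pow_left _
  have hwp : w ^ p = 1 := by rw [hw, ← pow_mul, mul_comm, pow_mul, hzp, one_pow]
  have hw2 : w ^ 2 * z = 1 := by
    rw [pow_two, hw, ← pow_val_add hzp]
    have : (-2⁻¹ + -2⁻¹ : ZMod p) = ((p - 1 : ℕ) : ZMod p) := by
      rw [Nat.cast_sub (Fact.out : p.Prime).one_lt.le]
      field_simp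
      simp
      norm_num
    rw [this, pow_val_natCast hzp, ← pow_succ, Nat.sub_add_cancel (Fact.out : p.Prime).one_lt.le,
      hzp]
  have hw1 : w ≠ 1 := by
    intro h; rw [h] at hw2; simp at hw2; exact hz1 hw2
  have hyx : y * x = x * y * w ^ 2 := by
    rw [hxy, mul_assoc, ((Commute.refl z).pow_left _ |>.pow_left 2 : Commute (w ^ 2) z).symm.eq,
      hw2, mul_one]
  have hcomm : ∀ m n : ℕ, y ^ m * x ^ n = x ^ n * y ^ m * w ^ (2 * (m * n)) := by
    intro m n
    rw [pow_mul_pow_of_comm (hwx.pow_left 2) (hwy.pow_left 2) hyx, ← pow_mul]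
  have hval : ∀ m n : ZMod p, w ^ (2 * (m.val * n.val)) = w ^ (2 * m * n).val := by
    intro m n
    rw [← pow_val_natCast hwp]
    congr 2
    push_cast
    simp only [ZMod.natCast_zmod_val]
    ring
  -- In `E`, `t a b c = (t 0 1 0) ^ b * (t 0 0 1) ^ c * (t 1 0 0) ^ (a + b * c)`.
  let φ : ZMod p × ZMod p × ZMod p → G := fun v =>
    x ^ v.2.1.val * y ^ v.2.2.val * w ^ (v.1 + v.2.1 * v.2.2).val
  have hφ : ∀ u v, φ u * φ v = φ (u.1 + v.1 - u.2.1 * v.2.2 + u.2.2 * v.2.1,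
      u.2.1 + v.2.1, u.2.2 + v.2.2) := by
    rintro ⟨a, b, c⟩ ⟨a', b', c'⟩
    simp only [φ]
    have e1 : ∀ (i : ℕ) (j : ℕ), w ^ i * x ^ j = x ^ j * w ^ i := fun i j =>
      ((hwx.pow_left i).pow_right j).eq
    have e2 : ∀ (i : ℕ) (j : ℕ), w ^ i * y ^ j = y ^ j * w ^ i := fun i j =>
      ((hwy.pow_left i).pow_right j).eq
    have e3 : (a + a' - b * c' + c * b' + (b + b') * (c + c') : ZMod p) =
        2 * c * b' + (a + b * c) + (a' + b' * c') := by ring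
    rw [e3, pow_val_add hwp (2 * c * b' + _), pow_val_add hwp (2 * c * b'), pow_val_add hx,
      pow_val_add hy, ← hval]
    calc _ = x ^ b.val * y ^ c.val * (w ^ (a + b * c).val * x ^ b'.val) * y ^ c'.val *
          w ^ (a' + b' * c').val := by simp only [mul_assoc]
      _ = x ^ b.val * (y ^ c.val * x ^ b'.val) * (w ^ (a + b * c).val * y ^ c'.val) *
          w ^ (a' + b' * c').val := by rw [e1]; simp only [mul_assoc]
      _ = x ^ b.val * x ^ b'.val * y ^ c.val * (w ^ (2 * (c.val * b'.val)) * y ^ c'.val) *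
          w ^ (a + b * c).val * w ^ (a' + b' * c').val := by
        rw [hcomm, e2]; simp only [mul_assoc]
      _ = _ := by rw [e2]; simp only [mul_assoc]
  have hone : ((1 : ZMod p).val) = 1 := ZMod.val_one p
  let f : E (ZMod p) →* G := MonoidHom.mk' (fun g => φ ((eEquiv _).symm g)) (by
    intro g h
    obtain ⟨u, rfl⟩ := (eEquiv (ZMod p)).surjective g
    obtain ⟨v, rfl⟩ := (eEquiv (ZMod p)).surjective h
    rw [eEquiv_mul]
    simp only [Equiv.symm_apply_apply]
    exact (hφ u v).symm)
  have hf : ∀ v, f (eEquiv _ v) = φ v := fun v => by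
    simp only [f, MonoidHom.mk'_apply, Equiv.symm_apply_apply]
  refine ⟨f, injective_of_map_ne_one h2 f ?_, ⟨eEquiv _ (0, 1, 0), ?_⟩, ⟨eEquiv _ (0, 0, 1), ?_⟩⟩
  · rw [hf]; simpa [φ, hone] using hw1
  · rw [hf]; simp [φ, hone]
  · rw [hf]; simp [φ, hone]

theorem card_e : Nat.card (E (ZMod p)) = p ^ 3 := by
  rw [← Nat.card_congr (eEquiv (ZMod p)), Nat.card_prod, Nat.card_prod, Nat.card_zmod]; ring

/-- The commutators of a group of order `p³` are central, because the centre has order at least `p`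
and groups of order at most `p²` are abelian. -/
theorem commutator_mem_center (hG : Nat.card G = p ^ 3) (x y : G) :
    ⁅x, y⁆ ∈ Subgroup.center G := by
  obtain ⟨k, hk, hZ⟩ := IsPGroup.card_center_eq_prime_pow hG (by norm_num)
  have hp : 0 < p := (Fact.out : p.Prime).pos
  have hmul := Subgroup.card_mul_index (Subgroup.center G)
  rw [hG, hZ] at hmul
  have hdvd : (Subgroup.center G).index ∣ p ^ 2 := by
    obtain ⟨k, rfl⟩ := Nat.exists_eq_succ_of_ne_zero hk.ne'
    refine ⟨p ^ k, ?_⟩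
    refine Nat.eq_of_mul_eq_mul_left hp ?_
    rw [← pow_succ', ← hmul, Nat.succ_eq_add_one]; ring
  have : IsMulCommutative (G ⧸ Subgroup.center G) := by
    obtain ⟨i, hi, hidx⟩ := (Nat.dvd_prime_pow (Fact.out : p.Prime)).1 hdvd
    rw [Subgroup.index] at hidx
    interval_cases i
    · have := (Nat.card_eq_one_iff_unique.1 hidx).1
      exact ⟨⟨fun a b => Subsingleton.elim _ _⟩⟩
    · have := isCyclic_of_prime_card (p := p) (by simpa using hidx)
      infer_instance
    · exact IsPGroup.isMulCommutative_of_card_eq_prime_sq hidx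
  exact Subgroup.Normal.quotient_commutative_iff_commutator_le.1 this
    (Subgroup.commutator_mem_commutator (Subgroup.mem_top x) (Subgroup.mem_top y))

/-- A nonabelian group of order `p³` and exponent `p` is isomorphic to `E`. -/
theorem nonempty_mulEquiv_e (h2 : (2 : ZMod p) ≠ 0) (hG : Nat.card G = p ^ 3)
    (hexp : ∀ g : G, g ^ p = 1) (hna : ∃ x y : G, x * y ≠ y * x) :
    Nonempty (G ≃* E (ZMod p)) := by
  obtain ⟨x, y, hxy⟩ := hna
  have hz := Subgroup.mem_center_iff.1 (commutator_mem_center hG x y)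
  obtain ⟨f, hf, -⟩ := exists_hom_of_commute h2 (hexp x) (hexp y) hxy (hz x).symm (hz y).symm
  have : Finite G := Nat.finite_of_card_ne_zero (by
    rw [hG]; exact pow_ne_zero _ (NeZero.ne p))
  exact ⟨(MulEquiv.ofBijective f ((Nat.bijective_iff_injective_and_card f).2
    ⟨hf, by rw [hG, card_e]⟩)).symm⟩

end Heisenberg

/-! ### Groups acting regularly on the coordinate model -/

section Regular

variable {p : ℕ} [Fact p.Prime]

/-- In dimension at most `p` over `ZMod p`, a linear map of `p`-power order has order dividing `p`:
it is unipotent. -/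
theorem pow_prime_eq_one {W : Type*} [AddCommGroup W] [Module (ZMod p) W]
    [Module.Finite (ZMod p) W] (hW : Module.finrank (ZMod p) W ≤ p)
    {X : Module.End (ZMod p) W} {n : ℕ} (hX : X ^ p ^ n = 1) : X ^ p = 1 := by
  rcases subsingleton_or_nontrivial W with _ | _
  · exact Subsingleton.elim _ _
  have : CharP (Module.End (ZMod p) W) p :=
    charP_of_injective_algebraMap (algebraMap (ZMod p) (Module.End (ZMod p) W)).injective p
  have hnil : IsNilpotent (X - 1) :=
    ⟨p ^ n, by rw [sub_pow_char_pow_of_commute _ _ (Commute.one_right X), hX, one_pow, sub_self]⟩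
  have h0 : (X - 1) ^ Module.finrank (ZMod p) W = 0 := by
    have := LinearMap.aeval_self_charpoly (X - 1)
    rwa [hnil.charpoly_eq_X_pow_finrank, map_pow, Polynomial.aeval_X] at this
  have h1 : (X - 1) ^ p = 0 := pow_eq_zero_of_le hW h0
  rwa [sub_pow_char_of_commute _ (Commute.one_right X), one_pow, sub_eq_zero] at h1

/-- The extension to `F⁴` of the affine map `(a, v) ↦ (a + wedge m (A v) + k, A v + m)`. -/
def affineExtension (A : ZMod p × ZMod p →ₗ[ZMod p] ZMod p × ZMod p) (k : ZMod p)
    (m : ZMod p × ZMod p) : Module.End (ZMod p) (ZMod p × ZMod p × ZMod p × ZMod p) where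
  toFun y := (y.1, y.2.1 + wedge m (A y.2.2) + y.1 * k, A y.2.2 + y.1 • m)
  map_add' y z := by
    simp only [Prod.fst_add, Prod.snd_add, map_add, wedge_add_right, add_smul]
    refine Prod.ext rfl (Prod.ext ?_ ?_)
    · simp only [Prod.fst_add, Prod.snd_add]; ring
    · simp only [Prod.snd_add]; abel
  map_smul' c y := by
    simp only [Prod.smul_fst, Prod.smul_snd, map_smul, wedge_smul_right, smul_eq_mul,
      RingHom.id_apply]
    refine Prod.ext rfl (Prod.ext ?_ ?_)
    · simp only [Prod.smul_fst, Prod.smul_snd, smul_eq_mul]; ring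
    · simp only [Prod.smul_snd, smul_add, mul_smul]

theorem two_ne_zero_of_five_le (hp : 5 ≤ p) : (2 : ZMod p) ≠ 0 := by
  intro h
  have := Nat.le_of_dvd (by norm_num) ((ZMod.natCast_eq_zero_iff 2 p).1 (by exact_mod_cast h))
  omega

theorem three_ne_zero_of_five_le (hp : 5 ≤ p) : (3 : ZMod p) ≠ 0 := by
  intro h
  have := Nat.le_of_dvd (by norm_num) ((ZMod.natCast_eq_zero_iff 3 p).1 (by exact_mod_cast h))
  omega

variable {σ : Equiv.Perm (ZMod p × ZMod p × ZMod p)}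

/-- An automorphism of the graph of `p`-power order is affine with unipotent linear part; in
particular the determinant occurring in `exists_affine` is `1`. -/
theorem exists_affine_of_pow (hp : 5 ≤ p) {n : ℕ} (hσ : ∀ y z, Adj (σ y) (σ z) ↔ Adj y z)
    (hn : σ ^ p ^ n = 1) :
    ∃ A : Module.End (ZMod p) (ZMod p × ZMod p), A ^ p ^ n = 1 ∧
      ∀ y, σ y = (y.1 + wedge (σ 0).2 (A y.2) + (σ 0).1, A y.2 + (σ 0).2) := by
  obtain ⟨A, d, hd, hA⟩ := exists_affine (two_ne_zero_of_five_le hp)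
    (three_ne_zero_of_five_le hp) hσ
  have hiter : ∀ (i : ℕ) (u v : ZMod p × ZMod p),
      ((σ ^ i) (0, u + v)).2 - ((σ ^ i) (0, v)).2 = ((A : Module.End _ _) ^ i) u := by
    intro i u v
    induction i with
    | zero => simp
    | succ i ih =>
      rw [pow_succ', pow_succ', Equiv.Perm.mul_apply, Equiv.Perm.mul_apply, Module.End.mul_apply,
        ← ih, hA ((σ ^ i) (0, u + v)), hA ((σ ^ i) (0, v)), map_sub]
      simp only [add_sub_add_right_eq_sub]
  have hA1 : (A : Module.End _ _) ^ p ^ n = 1 := by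
    ext1 <;> ext1 <;> rw [LinearMap.comp_apply, ← hiter _ _ 0, hn] <;> simp
  have hdet : ∀ (i : ℕ) (u v : ZMod p × ZMod p),
      wedge (((A : Module.End _ _) ^ i) u) (((A : Module.End _ _) ^ i) v) = d ^ i * wedge u v := by
    intro i u v
    induction i with
    | zero => simp
    | succ i ih =>
      rw [pow_succ', Module.End.mul_apply, Module.End.mul_apply, hd, ih, pow_succ']; ring
  have hd1 : d = 1 := by
    have := hdet (p ^ n) (1, 0) (0, 1)
    rw [hA1, ZMod.pow_card_pow] at this
    simpa [wedge] using this.symm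
  refine ⟨A, hA1, fun y => ?_⟩
  rw [hA y, hd1, one_mul]

theorem pow_prime_eq_one_of_adj (hp : 5 ≤ p) {n : ℕ} (hσ : ∀ y z, Adj (σ y) (σ z) ↔ Adj y z)
    (hn : σ ^ p ^ n = 1) : σ ^ p = 1 := by
  obtain ⟨A, -, hA⟩ := exists_affine_of_pow hp hσ hn
  set X := affineExtension A (σ 0).1 (σ 0).2 with hX
  have hiter : ∀ (i : ℕ) (y : ZMod p × ZMod p × ZMod p), (X ^ i) (1, y) = (1, (σ ^ i) y) := by
    intro i y
    induction i with
    | zero => simp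
    | succ i ih =>
      rw [pow_succ', pow_succ', Module.End.mul_apply, ih, Equiv.Perm.mul_apply,
        hA ((σ ^ i) y)]
      simp [hX, affineExtension]
  have hX1 : X ^ p ^ n = 1 := by
    -- The vectors `(1, y)` span.
    have h1 : ∀ y, (X ^ p ^ n) (1, y) = (1, y) := fun y => by rw [hiter, hn]; rfl
    refine LinearMap.ext fun z => ?_
    have hz : z = (1, z.2) + (z.1 - 1) • (1, 0) := by ext <;> simp
    rw [hz, map_add, map_smul, h1, h1, Module.End.one_apply]
  have hXp := pow_prime_eq_one (by simp; omega) hX1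
  refine Equiv.ext fun y => ?_
  have := hiter p y
  rw [hXp] at this
  exact (congrArg Prod.snd this).symm

variable {G : Type*} [Group G]

/-- A group acting regularly on the vertices of the graph, by automorphisms, is isomorphic
to `E`. -/
theorem nonempty_mulEquiv_e_of_regular (hp : 5 ≤ p)
    (ψ : G →* Equiv.Perm (ZMod p × ZMod p × ZMod p))
    (hadj : ∀ g y z, Adj (ψ g y) (ψ g z) ↔ Adj y z) (htrans : ∀ y, ∃ g, ψ g 0 = y)
    (hfree : ∀ g, ψ g 0 = 0 → g = 1) : Nonempty (G ≃* E (ZMod p)) := by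
  have h2 := two_ne_zero_of_five_le hp
  have hcard : Nat.card G = p ^ 3 := by
    have hbij : Function.Bijective (fun g => ψ g 0) := by
      refine ⟨fun g h hgh => ?_, htrans⟩
      have := hfree (h⁻¹ * g) (by
        rw [map_mul, Equiv.Perm.mul_apply]
        simp only at hgh
        rw [hgh, map_inv]; simp)
      rwa [inv_mul_eq_one, eq_comm] at this
    rw [Nat.card_congr (Equiv.ofBijective _ hbij), Nat.card_prod, Nat.card_prod, Nat.card_zmod]
    ring
  have hpow : ∀ g, ψ g ^ p ^ 3 = 1 := fun g => by
    rw [← map_pow, ← hcard, pow_card_eq_one', map_one]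
  refine nonempty_mulEquiv_e h2 hcard (fun g => hfree _ ?_) ?_
  · rw [map_pow, pow_prime_eq_one_of_adj hp (hadj g) (hpow g)]; rfl
  -- Suppose that `G` is abelian, and let `g` move the origin to `(0, m)` with `m ≠ 0`.
  by_contra! hab
  obtain ⟨g, hg⟩ := htrans (0, 1, 0)
  obtain ⟨A, hA1, hA⟩ := exists_affine_of_pow hp (hadj g) (hpow g)
  set m : ZMod p × ZMod p := (1, 0) with hm
  rw [hg] at hA
  have hm0 : m ≠ 0 := by simp [hm]
  -- Comparing the images of the origin under `g * h` and `h * g`, where `h` moves it to `(0, n)`.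
  have key : ∀ n, wedge (m - n) (A n + m) = 0 := by
    intro n
    obtain ⟨h, hh⟩ := htrans (0, n)
    obtain ⟨B, -, hB⟩ := exists_affine_of_pow hp (hadj h) (hpow h)
    rw [hh] at hB
    have := congrArg (fun x => ψ x 0) (hab g h)
    simp only [map_mul, Equiv.Perm.mul_apply] at this
    rw [hg, hh, hA (0, n), hB (0, m)] at this
    simp only [zero_add, add_zero, Prod.mk.injEq] at this
    obtain ⟨e1, e2⟩ := this
    have e3 : wedge m (A n + m) = wedge n (A n + m) := by
      rw [wedge_add_right, wedge_self, add_zero, e2, wedge_add_right, wedge_self, add_zero, e1]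
    rw [wedge_sub_left, e3, sub_self]
  -- Separating the linear and the quadratic terms in `n`.
  have hlin : ∀ n, wedge m (A n) = wedge n m := by
    intro n
    have k1 := key n
    have k2 := key (-n)
    simp only [wedge_sub_left, wedge_add_right, wedge_self, map_neg] at k1 k2
    have hneg : ∀ u v : ZMod p × ZMod p, wedge u (-v) = -wedge u v := fun u v => by
      simp only [wedge, Prod.fst_neg, Prod.snd_neg]; ring
    have hneg' : ∀ u v : ZMod p × ZMod p, wedge (-u) v = -wedge u v := fun u v => by
      rw [wedge_swap, hneg, wedge_swap v u, neg_neg]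
    simp only [hneg, hneg'] at k1 k2
    have : 2 * (wedge m (A n) - wedge n m) = 0 := by linear_combination k1 - k2
    exact sub_eq_zero.1 ((mul_eq_zero.1 this).resolve_left h2)
  have hquad : ∀ n, wedge n (A n) = 0 := by
    intro n
    have k1 := key n
    simp only [wedge_sub_left, wedge_add_right, wedge_self, hlin] at k1
    linear_combination -k1
  -- Polarizing the second identity turns the first into `A m = -m`, whereas `A` has odd order.
  have hAm : A m = -m := by
    have hbil : ∀ n, wedge n (A m) = -wedge m (A n) := fun n => by
      have := hquad (n + m)
      simp only [map_add, wedge_add_left, wedge_add_right, hquad] at this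
      linear_combination this
    have hz : ∀ n, wedge (A m + m) n = 0 := fun n => by
      rw [wedge_add_left, wedge_swap (A m), hbil, hlin, wedge_swap n m]; ring
    by_contra hne
    have hne' : A m + m ≠ 0 := fun h => hne (eq_neg_of_add_eq_zero_left h)
    obtain ⟨v, hv⟩ := exists_wedge_eq hne' 1
    rw [hz] at hv
    exact zero_ne_one hv
  have hiter : ∀ i : ℕ, (A ^ i) m = (-1 : ZMod p) ^ i • m := by
    intro i
    induction i with
    | zero => simp
    | succ i ih => rw [pow_succ', Module.End.mul_apply, ih, map_smul, hAm, pow_succ]; simp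
  have hfin := hiter (p ^ 3)
  rw [hA1, ZMod.pow_card_pow, Module.End.one_apply] at hfin
  have := congrArg Prod.fst hfin
  simp only [hm, Prod.smul_fst, smul_eq_mul, mul_one] at this
  exact h2 (by linear_combination this)

end Regular

/-! ### The groups `E` and `P` -/

section GroupsEP

open scoped commutatorElement

theorem t_pow {F : Type*} [Field F] (a b c : F) (n : ℕ) :
    t a b c ^ n = t (n * a) (n * b) (n * c) := by
  induction n with
  | zero => simp [t_zero]
  | succ n ih => rw [pow_succ, ih, t_mul_t]; push_cast; congr 1 <;> ring

variable {p : ℕ} [Fact p.Prime]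

theorem t_pow_prime (a b c : ZMod p) : t a b c ^ p = 1 := by
  rw [t_pow, CharP.cast_eq_zero, zero_mul, zero_mul, zero_mul, t_zero]

theorem exponent_e : Monoid.exponent (E (ZMod p)) = p := by
  have hdvd : Monoid.exponent (E (ZMod p)) ∣ p := by
    refine Monoid.exponent_dvd_of_forall_pow_eq_one ?_
    rintro ⟨_, a, b, c, rfl⟩
    exact Subtype.ext (t_pow_prime a b c)
  refine ((Nat.dvd_prime Fact.out).1 hdvd).resolve_left fun h => ?_
  have := Monoid.exp_eq_one_iff.1 h
  have h1 := (eEquiv (ZMod p)).injective (this.elim (eEquiv _ (1, 0, 0)) (eEquiv _ 0))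
  simp at h1

variable (p) in
/-- The homomorphism `t a b c ↦ (b, c)` on `E`. -/
noncomputable def eToPlane : E (ZMod p) →* Multiplicative (ZMod p × ZMod p) :=
  MonoidHom.mk' (fun g => Multiplicative.ofAdd ((eEquiv _).symm g).2) (by
    intro g h
    obtain ⟨u, rfl⟩ := (eEquiv (ZMod p)).surjective g
    obtain ⟨v, rfl⟩ := (eEquiv (ZMod p)).surjective h
    rw [eEquiv_mul]
    simp only [Equiv.symm_apply_apply]
    rfl)

theorem eToPlane_apply (y : ZMod p × ZMod p × ZMod p) :
    eToPlane p (eEquiv _ y) = Multiplicative.ofAdd y.2 := by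
  simp [eToPlane]

theorem eEquiv_mem_ker {y : ZMod p × ZMod p × ZMod p} :
    eEquiv _ y ∈ (eToPlane p).ker ↔ y.2 = 0 := by
  rw [MonoidHom.mem_ker, eToPlane_apply, ofAdd_eq_one]

theorem center_e (h2 : (2 : ZMod p) ≠ 0) : Subgroup.center (E (ZMod p)) = (eToPlane p).ker := by
  ext g
  obtain ⟨⟨a, b, c⟩, rfl⟩ := (eEquiv (ZMod p)).surjective g
  rw [eEquiv_mem_ker, Subgroup.mem_center_iff]
  constructor
  · intro h
    have h1 := h (eEquiv _ (0, 1, 0))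
    have h3 := h (eEquiv _ (0, 0, 1))
    rw [eEquiv_mul, eEquiv_mul, (eEquiv _).apply_eq_iff_eq] at h1 h3
    have e1 := congrArg Prod.fst h1
    have e3 := congrArg Prod.fst h3
    simp only [zero_add, add_zero, one_mul, mul_one, zero_mul, mul_zero, sub_zero] at e1 e3
    refine Prod.ext ?_ ?_
    · exact (mul_eq_zero.1 (show 2 * b = 0 by linear_combination e3)).resolve_left h2
    · exact (mul_eq_zero.1 (show 2 * c = 0 by linear_combination -e1)).resolve_left h2
  · intro h g
    obtain ⟨⟨a', b', c'⟩, rfl⟩ := (eEquiv (ZMod p)).surjective g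
    obtain ⟨rfl, rfl⟩ : b = 0 ∧ c = 0 := by simpa using h
    rw [eEquiv_mul, eEquiv_mul]
    congr 1
    ext <;> simp; ring

theorem commutator_e (h2 : (2 : ZMod p) ≠ 0) : commutator (E (ZMod p)) = (eToPlane p).ker := by
  apply le_antisymm
  · exact Abelianization.commutator_subset_ker _
  · intro g hg
    obtain ⟨⟨a, b, c⟩, rfl⟩ := (eEquiv (ZMod p)).surjective g
    obtain ⟨rfl, rfl⟩ : b = 0 ∧ c = 0 := by simpa using eEquiv_mem_ker.1 hg
    have : eEquiv (ZMod p) (a, 0, 0) =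
        ⁅eEquiv (ZMod p) (0, 0, a / 2), eEquiv (ZMod p) (0, 1, 0)⁆ := by
      rw [commutatorElement_def, eq_mul_inv_iff_mul_eq, eq_mul_inv_iff_mul_eq, eEquiv_mul,
        eEquiv_mul, eEquiv_mul]
      congr 1
      ext
      · simp; field_simp; ring
      · simp
      · simp
    rw [this]
    exact Subgroup.commutator_mem_commutator (Subgroup.mem_top _) (Subgroup.mem_top _)

/-- A maximal subgroup `M` that does not contain the centre is normal with abelian quotient, so it
contains all commutators. -/
theorem center_le_frattini {G : Type*} [Group G] (h : Subgroup.center G = commutator G) :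
    Subgroup.center G ≤ frattini G := by
  refine le_iInf₂ fun M hM => ?_
  by_contra hle
  have htop : M ⊔ Subgroup.center G = ⊤ := hM.2 _ (lt_of_le_of_ne le_sup_left fun he =>
    hle (he ▸ le_sup_right))
  have hMn : M.Normal := by
    refine ⟨fun m hm g => ?_⟩
    have hg : g ∈ M ⊔ Subgroup.center G := htop ▸ Subgroup.mem_top g
    obtain ⟨n, hn, z, hz, rfl⟩ := Subgroup.mem_sup_of_normal_right.1 hg
    have : n * z * m * (n * z)⁻¹ = n * m * n⁻¹ := by
      have hzm := (Subgroup.mem_center_iff.1 hz m).symm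
      rw [mul_assoc n z m, hzm]; group
    rw [this]
    exact M.mul_mem (M.mul_mem hn hm) (M.inv_mem hn)
  apply hle
  rw [h]
  exact Subgroup.Normal.commutator_le_of_self_sup_commutative_eq_top htop inferInstance

theorem frattini_e (h2 : (2 : ZMod p) ≠ 0) : frattini (E (ZMod p)) = (eToPlane p).ker := by
  apply le_antisymm
  · -- The two coordinates of `eToPlane` are homomorphisms onto a group of order `p`.
    have hco : ∀ f : E (ZMod p) →* Multiplicative (ZMod p), Function.Surjective f →
        frattini (E (ZMod p)) ≤ f.ker := by
      intro f hf
      have : IsSimpleGroup (Multiplicative (ZMod p)) :=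
        isSimpleGroup_of_prime_card (p := p) (Nat.card_zmod p)
      have hbot : IsCoatom (⊥ : Subgroup (Multiplicative (ZMod p))) := by
        refine ⟨bot_ne_top, fun H hH => ?_⟩
        exact ((Subgroup.Normal.eq_bot_or_eq_top (H := H) inferInstance)).resolve_left hH.ne'
      have := frattini_le_coatom (Subgroup.isCoatom_comap_of_surjective hf hbot)
      rwa [MonoidHom.comap_bot] at this
    let f₁ := (AddMonoidHom.toMultiplicative (AddMonoidHom.fst (ZMod p) (ZMod p))).comp (eToPlane p)
    let f₂ := (AddMonoidHom.toMultiplicative (AddMonoidHom.snd (ZMod p) (ZMod p))).comp (eToPlane p)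
    have hf₁ : ∀ y, f₁ (eEquiv _ y) = Multiplicative.ofAdd y.2.1 := fun y => by
      simp only [f₁, MonoidHom.comp_apply, eToPlane_apply]; rfl
    have hf₂ : ∀ y, f₂ (eEquiv _ y) = Multiplicative.ofAdd y.2.2 := fun y => by
      simp only [f₂, MonoidHom.comp_apply, eToPlane_apply]; rfl
    intro g hg
    have h1 := hco f₁ (fun b => ⟨eEquiv _ (0, b.toAdd, 0), hf₁ _⟩) hg
    have h3 := hco f₂ (fun c => ⟨eEquiv _ (0, 0, c.toAdd), hf₂ _⟩) hg
    obtain ⟨y, rfl⟩ := (eEquiv (ZMod p)).surjective g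
    rw [MonoidHom.mem_ker, hf₁, ofAdd_eq_one] at h1
    rw [MonoidHom.mem_ker, hf₂, ofAdd_eq_one] at h3
    exact eEquiv_mem_ker.2 (Prod.ext h1 h3)
  · rw [← center_e h2]
    exact center_le_frattini ((center_e h2).trans (commutator_e h2).symm)

theorem isExtraspecial_e (h2 : (2 : ZMod p) ≠ 0) : IsExtraspecial p (E (ZMod p)) := by
  refine ⟨Finite.of_equiv _ (eEquiv (ZMod p)), IsPGroup.of_card card_e,
    (center_e h2).trans (commutator_e h2).symm, (commutator_e h2).trans (frattini_e h2).symm, ?_⟩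
  rw [center_e h2]
  have e : ZMod p ≃ (eToPlane p).ker := Equiv.ofBijective
    (fun a => ⟨eEquiv _ (a, 0, 0), eEquiv_mem_ker.2 rfl⟩) (by
      constructor
      · intro a b h
        simpa using h
      · rintro ⟨g, hg⟩
        obtain ⟨⟨a, v⟩, rfl⟩ := (eEquiv (ZMod p)).surjective g
        obtain rfl : v = 0 := eEquiv_mem_ker.1 hg
        exact ⟨a, rfl⟩)
  rw [← Nat.card_congr e, Nat.card_zmod]

theorem t_mul_theta {F : Type*} [Field F] (α a b : F) :
    t a b 0 * theta α = theta α * t (a - 2 * α * b) b 0 := by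
  ext i j
  fin_cases i <;> fin_cases j <;>
    simp [t, theta, Matrix.mul_apply, Fin.sum_univ_four] <;> ring

/-- `theta α` is unipotent of size `4 ≤ p`. -/
theorem theta_pow_prime (hp : 5 ≤ p) (α : ZMod p) : theta α ^ p = 1 := by
  refine Units.ext ?_
  rw [Units.val_pow_eq_pow_val, Units.val_one]
  have h2 : ((theta α).val - 1) ^ 2 = !![0, 0, 0, 0; 0, 0, 0, 0; -α ^ 2, 0, 0, 0;
      -α ^ 3, α ^ 2, 0, 0] := by
    rw [pow_two]
    ext i j
    fin_cases i <;> fin_cases j <;>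
      simp [theta, Matrix.mul_apply, Fin.sum_univ_four, Matrix.one_apply] <;> ring
  have h4 : ((theta α).val - 1) ^ (2 * 2) = 0 := by
    rw [pow_mul _ 2 2, h2, pow_two]
    ext i j
    fin_cases i <;> fin_cases j <;> simp [Matrix.mul_apply, Fin.sum_univ_four]
  have h1 : ((theta α).val - 1) ^ p = 0 := pow_eq_zero_of_le (by omega) h4
  rwa [sub_pow_char_of_commute _ (Commute.one_right _), one_pow, sub_eq_zero] at h1

theorem nonempty_e_mulEquiv_p (hp : 5 ≤ p) {α : ZMod p} (hα : α ≠ 0) :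
    Nonempty (E (ZMod p) ≃* P α) := by
  have h2 := two_ne_zero_of_five_le hp
  have hc : -2 * α ≠ 0 := mul_ne_zero (neg_ne_zero.2 h2) hα
  let x : P α := ⟨t 0 1 0, Subgroup.subset_closure (Or.inl ⟨0, 1, rfl⟩)⟩
  let y : P α := ⟨theta α, Subgroup.subset_closure (Or.inr rfl)⟩
  let z : P α := ⟨t (-2 * α) 0 0, Subgroup.subset_closure (Or.inl ⟨_, 0, rfl⟩)⟩
  have hzx : Commute z x := Subtype.ext (by
    change t (-2 * α) 0 0 * t 0 1 0 = t 0 1 0 * t (-2 * α) 0 0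
    rw [t_mul_t, t_mul_t]; congr 1 <;> ring)
  have hzy : Commute z y := Subtype.ext (by
    change t (-2 * α) 0 0 * theta α = theta α * t (-2 * α) 0 0
    rw [t_mul_theta, mul_zero, sub_zero])
  have hxy : x * y = y * x * z := Subtype.ext (by
    change t 0 1 0 * theta α = theta α * t 0 1 0 * t (-2 * α) 0 0
    rw [t_mul_theta, mul_assoc (theta α), t_mul_t]; congr 2 <;> ring)
  have hz1 : z ≠ 1 := fun h => hc (t_injective.1 ((congrArg Subtype.val h).trans t_zero.symm)).1
  have hz : ⁅x, y⁆ = z := by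
    rw [commutatorElement_def, hxy, mul_assoc y x z, ← hzx.eq, mul_inv_eq_iff_eq_mul,
      mul_inv_eq_iff_eq_mul, ← mul_assoc, hzy.eq]
  obtain ⟨f, hf, ⟨gx, hgx⟩, ⟨gy, hgy⟩⟩ := exists_hom_of_commute h2 (x := x) (y := y)
    (Subtype.ext (t_pow_prime 0 1 0)) (Subtype.ext (theta_pow_prime hp α))
    (fun h => hz1 (by rwa [hxy, mul_eq_left] at h)) (hz ▸ hzx) (hz ▸ hzy)
  refine ⟨MulEquiv.ofBijective f ⟨hf, ?_⟩⟩
  have hle : P α ≤ f.range.map (P α).subtype := by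
    refine (Subgroup.closure_le _).2 ?_
    have hx' : t 0 1 0 ∈ f.range.map (P α).subtype := ⟨x, ⟨gx, hgx⟩, rfl⟩
    have hy' : theta α ∈ f.range.map (P α).subtype := ⟨y, ⟨gy, hgy⟩, rfl⟩
    have hz' : t (-2 * α) 0 0 ∈ f.range.map (P α).subtype :=
      ⟨z, ⟨⁅gx, gy⁆, by rw [map_commutatorElement, hgx, hgy, hz]⟩, rfl⟩
    rintro _ (⟨a, b, rfl⟩ | rfl)
    · have : t a b 0 = t (-2 * α) 0 0 ^ (a / (-2 * α)).val * t 0 1 0 ^ b.val := by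
        rw [t_pow, t_pow, t_mul_t, ZMod.natCast_zmod_val, ZMod.natCast_zmod_val,
          div_mul_cancel₀ _ hc]
        congr 1 <;> ring
      rw [this]
      exact mul_mem (pow_mem hz' _) (pow_mem hx' _)
    · exact hy'
  rintro ⟨g, hg⟩
  obtain ⟨g', ⟨e, he⟩, hg'⟩ := hle hg
  exact ⟨e, he.trans (Subtype.ext hg')⟩

end GroupsEP

/-! ### Coordinates on the Payne derived quadrangle -/

section Coordinates

variable {F : Type*} [Field F]

theorem form_self (u : Fin 4 → F) : form F u u = 0 := by simp only [form]; ring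

theorem form_swap (u v : Fin 4 → F) : form F u v = -form F v u := by simp only [form]; ring

theorem form_add_left (u v w : Fin 4 → F) : form F (u + v) w = form F u w + form F v w := by
  simp only [form, Pi.add_apply]; ring

theorem form_add_right (u v w : Fin 4 → F) : form F u (v + w) = form F u v + form F u w := by
  simp only [form, Pi.add_apply]; ring

theorem form_smul_left (c : F) (u v : Fin 4 → F) : form F (c • u) v = c * form F u v := by
  simp only [form, Pi.smul_apply, smul_eq_mul]; ring

theorem form_smul_right (c : F) (u v : Fin 4 → F) : form F u (c • v) = c * form F u v := by
  simp only [form, Pi.smul_apply, smul_eq_mul]; ring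

theorem eq_zero_of_form {u : Fin 4 → F} (h : ∀ v, form F u v = 0) : u = 0 := by
  have h0 := h ![0, 0, 0, 1]
  have h1 := h ![0, 0, 1, 0]
  have h2 := h ![0, 1, 0, 0]
  have h3 := h ![1, 0, 0, 0]
  simp [form] at h0 h1 h2 h3
  ext i
  fin_cases i <;> assumption

theorem exists_form_eq_one {u : Fin 4 → F} (hu : u ≠ 0) : ∃ v, form F u v = 1 := by
  by_contra! h
  refine hu (eq_zero_of_form fun v => ?_)
  by_contra hv
  exact h ((form F u v)⁻¹ • v) (by rw [form_smul_right, inv_mul_cancel₀ hv])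

/-- The first vector of a symplectic basis may be prescribed: the isometries are transitive on
nonzero vectors. -/
theorem exists_isometry {e : Fin 4 → F} (he : e ≠ 0) :
    ∃ Φ : (Fin 4 → F) ≃ₗ[F] (Fin 4 → F), (∀ u v, form F (Φ u) (Φ v) = form F u v) ∧
      Φ ![1, 0, 0, 0] = e := by
  obtain ⟨f, hef⟩ := exists_form_eq_one he
  obtain ⟨g, hg0, heg, hfg⟩ : ∃ g, g ≠ 0 ∧ form F e g = 0 ∧ form F f g = 0 := by
    let L : (Fin 4 → F) →ₗ[F] F × F :=
      { toFun := fun v => (form F e v, form F f v)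
        map_add' := fun u v => by rw [form_add_right, form_add_right]; rfl
        map_smul' := fun c v => by rw [form_smul_right, form_smul_right]; rfl }
    obtain ⟨g, hg, hg0⟩ := (Submodule.ne_bot_iff _).1
      (LinearMap.ker_ne_bot_of_finrank_lt (f := L) (by simp))
    exact ⟨g, hg0, congrArg Prod.fst hg, congrArg Prod.snd hg⟩
  obtain ⟨h₀, hgh₀⟩ := exists_form_eq_one hg0
  -- Make the fourth vector orthogonal to the hyperbolic pair `e, f`.
  obtain ⟨h, heh, hfh, hgh⟩ : ∃ h, form F e h = 0 ∧ form F f h = 0 ∧ form F g h = 1 := by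
    refine ⟨h₀ + (-form F e h₀) • f + form F f h₀ • e, ?_, ?_, ?_⟩ <;>
      simp only [form_add_right, form_smul_right, form_self, hef, form_swap f e, form_swap g e,
        form_swap g f, heg, hfg, hgh₀] <;> ring
  let Ψ : (Fin 4 → F) →ₗ[F] (Fin 4 → F) :=
    { toFun := fun c => c 0 • e + c 1 • g + c 2 • h + c 3 • f
      map_add' := fun u v => by simp only [Pi.add_apply, add_smul]; abel
      map_smul' := fun c v => by
        simp only [Pi.smul_apply, smul_eq_mul, mul_smul, smul_add, RingHom.id_apply] }
  have hΨ : ∀ u v, form F (Ψ u) (Ψ v) = form F u v := by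
    intro u v
    change form F (u 0 • e + u 1 • g + u 2 • h + u 3 • f)
      (v 0 • e + v 1 • g + v 2 • h + v 3 • f) = _
    simp only [form_add_left, form_add_right, form_smul_left, form_smul_right, form_self,
      form_swap f e, form_swap g e, form_swap h e, form_swap g f, form_swap h f, form_swap h g,
      hef, heg, heh, hfg, hfh, hgh]
    simp only [form]
    ring
  have hinj : Function.Injective Ψ := by
    rw [injective_iff_map_eq_zero]
    intro u hu
    refine eq_zero_of_form fun v => ?_
    rw [← hΨ, hu]
    simp [form]
  refine ⟨LinearEquiv.ofInjectiveEndo Ψ hinj, fun u v => ?_, ?_⟩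
  · simp only [LinearEquiv.coe_ofInjectiveEndo, hΨ]
  · rw [LinearEquiv.coe_ofInjectiveEndo]
    change (1 : F) • e + (0 : F) • g + (0 : F) • h + (0 : F) • f = e
    simp

theorem mk_submodule_le {u : Fin 4 → F} (hu : u ≠ 0) {l : Submodule F (Fin 4 → F)} :
    (Projectivization.mk F u hu).submodule ≤ l ↔ u ∈ l := by
  rw [Projectivization.submodule_mk, Submodule.span_singleton_le_iff_mem]

theorem collinear_of_linearIndependent {u w : Fin 4 → F} (h : LinearIndependent F ![u, w])
    (huw : form F u w = 0) {y z : Fin 4 → F} (hy : y ≠ 0) (hz : z ≠ 0)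
    (hyl : y ∈ Submodule.span F {u, w}) (hzl : z ∈ Submodule.span F {u, w}) :
    (W3 F).Collinear (Projectivization.mk F y hy) (Projectivization.mk F z hz) := by
  refine ⟨⟨Submodule.span F {u, w}, ?_, ?_⟩, (mk_submodule_le hy).2 hyl, (mk_submodule_le hz).2 hzl⟩
  · have := finrank_span_eq_card h
    rwa [Matrix.range_cons_cons_empty, Fintype.card_fin] at this
  · intro a ha b hb
    obtain ⟨a₁, a₂, rfl⟩ := Submodule.mem_span_pair.1 ha
    obtain ⟨b₁, b₂, rfl⟩ := Submodule.mem_span_pair.1 hb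
    simp only [form_add_left, form_add_right, form_smul_left, form_smul_right, form_self,
      form_swap w u, huw]
    ring

theorem collinear_mk_iff {u v : Fin 4 → F} (hu : u ≠ 0) (hv : v ≠ 0) :
    (W3 F).Collinear (Projectivization.mk F u hu) (Projectivization.mk F v hv) ↔
      form F u v = 0 := by
  constructor
  · rintro ⟨l, h1, h2⟩
    exact l.2.2 u ((mk_submodule_le hu).1 h1) v ((mk_submodule_le hv).1 h2)
  · intro h
    by_cases hi : LinearIndependent F ![u, v]
    · exact collinear_of_linearIndependent hi h hu hv (Submodule.subset_span (by simp))
        (Submodule.subset_span (by simp))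
    · obtain ⟨c, rfl⟩ : ∃ c : F, c • u = v := by
        by_contra! hc
        exact hi ((LinearIndependent.pair_iff' hu).2 hc)
      obtain ⟨Φ, hΦ, he⟩ := exists_isometry hu
      have hw : LinearIndependent F ![u, Φ ![0, 1, 0, 0]] := by
        refine (LinearIndependent.pair_iff' hu).2 fun a ha => ?_
        rw [← he, ← map_smul] at ha
        have := congrFun (Φ.injective ha) 1
        simp at this
      refine collinear_of_linearIndependent hw ?_ hu hv (Submodule.subset_span (by simp))
        (Submodule.smul_mem _ _ (Submodule.subset_span (by simp)))
      rw [← he, hΦ]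
      simp [form]

section Isometry

variable (Φ : (Fin 4 → F) ≃ₗ[F] (Fin 4 → F))

/-- The vector of `F⁴` with last coordinate `1` that represents a point of the model. -/
def toVec (y : F × F × F) : Fin 4 → F := ![y.1, y.2.1, y.2.2, 1]

theorem equiv_apply_ne_zero {c : Fin 4 → F} (hc : c ≠ 0) : Φ c ≠ 0 :=
  (map_ne_zero_iff Φ Φ.injective).2 hc

theorem toVec_ne_zero (y : F × F × F) : toVec y ≠ 0 := fun h => by
  simpa [toVec] using congrFun h 3

theorem base_ne_zero : (![1, 0, 0, 0] : Fin 4 → F) ≠ 0 := fun h => by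
  simpa using congrFun h 0

/-- The point of `W(3, F)` with coordinates `c` with respect to the basis given by `Φ`. -/
def point (c : Fin 4 → F) (hc : c ≠ 0) : (W3 F).Point :=
  Projectivization.mk F (Φ c) (equiv_apply_ne_zero Φ hc)

theorem point_surjective (y : (W3 F).Point) : ∃ c hc, point Φ c hc = y := by
  obtain ⟨u, hu, rfl⟩ : ∃ u hu, Projectivization.mk F u hu = y :=
    ⟨_, Projectivization.rep_nonzero y, Projectivization.mk_rep y⟩
  refine ⟨Φ.symm u, equiv_apply_ne_zero Φ.symm hu, ?_⟩
  simp only [point, LinearEquiv.apply_symm_apply]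
  rfl

variable {Φ}

theorem collinear_point_iff (hΦ : ∀ u v, form F (Φ u) (Φ v) = form F u v) {c d : Fin 4 → F}
    (hc : c ≠ 0) (hd : d ≠ 0) :
    (W3 F).Collinear (point Φ c hc) (point Φ d hd) ↔ form F c d = 0 :=
  (collinear_mk_iff _ _).trans (by rw [hΦ])

theorem not_collinear_toVec (hΦ : ∀ u v, form F (Φ u) (Φ v) = form F u v) (y : F × F × F) :
    ¬ (W3 F).Collinear (point Φ _ base_ne_zero) (point Φ _ (toVec_ne_zero y)) := by
  rw [collinear_point_iff hΦ]
  simp [form, toVec]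

/-- The points of the hyperbolic line through the base point and the point `(a, v)` are, apart
from the base point, those of the form `(b, v)`. -/
theorem mem_hyperbolic_iff (hΦ : ∀ u v, form F (Φ u) (Φ v) = form F u v) (y q : F × F × F) :
    point Φ _ (toVec_ne_zero y) ∈ (W3 F).perp ((W3 F).perp
      {point Φ _ base_ne_zero, point Φ _ (toVec_ne_zero q)}) ↔ y.2 = q.2 := by
  have hperp : ∀ c hc, point Φ c hc ∈ (W3 F).perp
      {point Φ _ base_ne_zero, point Φ _ (toVec_ne_zero q)} ↔
      c 3 = 0 ∧ c 0 = q.2.1 * c 2 - c 1 * q.2.2 := by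
    intro c hc
    have : point Φ c hc ∈ (W3 F).perp
        {point Φ _ base_ne_zero, point Φ _ (toVec_ne_zero q)} ↔
        (W3 F).Collinear (point Φ c hc) (point Φ _ base_ne_zero) ∧
        (W3 F).Collinear (point Φ c hc) (point Φ _ (toVec_ne_zero q)) := by
      simp [Geometry.perp]
    rw [this, collinear_point_iff hΦ, collinear_point_iff hΦ]
    simp only [form, toVec, Matrix.cons_val]
    constructor
    · rintro ⟨h1, h2⟩
      have h3 : c 3 = 0 := by linear_combination -h1
      exact ⟨h3, by rw [h3] at h2; linear_combination h2⟩
    · rintro ⟨h1, h2⟩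
      rw [h1, h2]
      constructor <;> ring
  constructor
  · intro h
    have key : ∀ b c : F, (b ≠ 0 ∨ c ≠ 0) →
        form F (toVec y) ![q.2.1 * c - b * q.2.2, b, c, 0] = 0 := by
      intro b c hbc
      have hne : ![q.2.1 * c - b * q.2.2, b, c, 0] ≠ 0 := fun h0 => by
        have h1 := congrFun h0 1
        have h2 := congrFun h0 2
        simp at h1 h2
        tauto
      rw [← collinear_point_iff hΦ (toVec_ne_zero y) hne]
      exact h _ ((hperp _ hne).2 (by simp))
    have k1 := key 0 1 (by simp)
    have k2 := key 1 0 (by simp)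
    simp [form, toVec] at k1 k2
    exact Prod.ext (by linear_combination k1) (by linear_combination -k2)
  · intro h w hw
    obtain ⟨c, hc, rfl⟩ := point_surjective Φ w
    obtain ⟨h1, h2⟩ := (hperp c hc).1 hw
    rw [collinear_point_iff hΦ]
    simp only [form, toVec, Matrix.cons_val]
    rw [h1, h2, h]
    ring

/-- The coordinates on the Payne derived quadrangle at the point `Φ ⟨(1, 0, 0, 0)⟩`. -/
noncomputable def payneEquiv (hΦ : ∀ u v, form F (Φ u) (Φ v) = form F u v) :
    F × F × F ≃ ((W3 F).payne (point Φ _ base_ne_zero)).Point :=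
  Equiv.ofBijective (fun y => ⟨point Φ _ (toVec_ne_zero y), not_collinear_toVec hΦ y⟩) (by
    constructor
    · intro y z h
      obtain ⟨a, ha⟩ := (Projectivization.mk_eq_mk_iff' F _ _ _ _).1 (congrArg Subtype.val h)
      rw [← map_smul] at ha
      have ha' := Φ.injective ha
      have h3 := congrFun ha' 3
      simp [toVec] at h3
      subst h3
      rw [one_smul] at ha'
      have h0 := congrFun ha' 0
      have h1 := congrFun ha' 1
      have h2 := congrFun ha' 2
      simp [toVec] at h0 h1 h2
      exact (Prod.ext h0 (Prod.ext h1 h2)).symm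
    · rintro ⟨w, hw⟩
      obtain ⟨c, hc, rfl⟩ := point_surjective Φ w
      have h3 : c 3 ≠ 0 := by
        intro h
        apply hw
        rw [collinear_point_iff hΦ]
        simp [form, h]
      refine ⟨(c 0 / c 3, c 1 / c 3, c 2 / c 3), Subtype.ext ?_⟩
      refine (Projectivization.mk_eq_mk_iff' F _ _ _ _).2 ⟨(c 3)⁻¹, ?_⟩
      rw [← map_smul]
      congr 1
      ext i
      fin_cases i <;> simp [toVec, h3] <;> field_simp)

/-- In coordinates, collinearity in the Payne derived quadrangle is the relation `Adj`. -/
theorem payne_collinear_iff (hΦ : ∀ u v, form F (Φ u) (Φ v) = form F u v) (y z : F × F × F) :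
    ((W3 F).payne (point Φ _ base_ne_zero)).Collinear (payneEquiv hΦ y) (payneEquiv hΦ z) ↔
      Adj y z := by
  have hform : form F (toVec y) (toVec z) = 0 ↔ y.1 - z.1 = wedge z.2 y.2 := by
    simp only [form, toVec, wedge, Matrix.cons_val]
    constructor <;> intro h <;> linear_combination h
  constructor
  · rintro ⟨m | ⟨H, q, hq, rfl⟩, hy, hz⟩
    · right
      rw [← hform, ← collinear_point_iff hΦ (toVec_ne_zero y) (toVec_ne_zero z)]
      exact ⟨m.1, hy, hz⟩
    · left
      obtain ⟨q, hq'⟩ := (payneEquiv hΦ).surjective ⟨q, hq⟩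
      obtain rfl : point Φ _ (toVec_ne_zero q) = _ := congrArg Subtype.val hq'
      exact ((mem_hyperbolic_iff hΦ y q).1 hy).trans ((mem_hyperbolic_iff hΦ z q).1 hz).symm
  · rintro (h | h)
    · exact ⟨Sum.inr ⟨_, _, not_collinear_toVec hΦ y, rfl⟩, (mem_hyperbolic_iff hΦ y y).2 rfl,
        (mem_hyperbolic_iff hΦ z y).2 h.symm⟩
    · rw [← hform, ← collinear_point_iff hΦ (toVec_ne_zero y) (toVec_ne_zero z)] at h
      obtain ⟨l, hy, hz⟩ := h
      exact ⟨Sum.inl ⟨l, fun hx => not_collinear_toVec hΦ y ⟨l, hx, hy⟩⟩, hy, hz⟩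

end Isometry

/-- For every point `x` of `W(3, F)` the points of the Payne derived quadrangle at `x` can be
identified with the vertices of the graph `Adj`. -/
theorem exists_payneEquiv (x : (W3 F).Point) : ∃ ε : F × F × F ≃ ((W3 F).payne x).Point,
    ∀ y z, ((W3 F).payne x).Collinear (ε y) (ε z) ↔ Adj y z := by
  obtain ⟨e, he, rfl⟩ : ∃ e he, Projectivization.mk F e he = x :=
    ⟨_, Projectivization.rep_nonzero x, Projectivization.mk_rep x⟩
  obtain ⟨Φ, hΦ, rfl⟩ := exists_isometry he
  exact ⟨payneEquiv hΦ, payne_collinear_iff hΦ⟩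

theorem Geometry.collinear_aut (Q : Geometry) (g : Q.aut) (y z : Q.Point) :
    Q.Collinear (g.1.1 y) (g.1.1 z) ↔ Q.Collinear y z := by
  constructor
  · rintro ⟨l, hy, hz⟩
    obtain ⟨l, rfl⟩ := g.1.2.surjective l
    exact ⟨l, (g.2 y l).1 hy, (g.2 z l).1 hz⟩
  · rintro ⟨l, hy, hz⟩
    exact ⟨g.1.2 l, (g.2 y l).2 hy, (g.2 z l).2 hz⟩

end Coordinates

end PayneGQ

theorem lemma3p11 (p : ℕ) [Fact p.Prime] (hp : 5 ≤ p) (α : ZMod p) (hα : α ≠ 0) :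
    (PayneGQ.IsExtraspecial p (PayneGQ.E (ZMod p)) ∧
      Nat.card (PayneGQ.E (ZMod p)) = p ^ 3 ∧
      Monoid.exponent (PayneGQ.E (ZMod p)) = p ∧
      Nonempty (PayneGQ.E (ZMod p) ≃* PayneGQ.P α)) ∧
    ∀ (x : (PayneGQ.W3 (ZMod p)).Point) (G : Type*) [Group G]
      (φ : G →* ((PayneGQ.W3 (ZMod p)).payne x).aut),
      ((PayneGQ.W3 (ZMod p)).payne x).ActsRegularlyOnPoints φ →
        Nonempty (G ≃* PayneGQ.E (ZMod p)) ∧ Nonempty (G ≃* PayneGQ.P α) := by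
  have h2 := PayneGQ.two_ne_zero_of_five_le hp
  obtain ⟨eP⟩ := PayneGQ.nonempty_e_mulEquiv_p hp hα
  refine ⟨⟨PayneGQ.isExtraspecial_e h2, PayneGQ.card_e, PayneGQ.exponent_e, ⟨eP⟩⟩, ?_⟩
  intro x G _ φ ⟨htrans, hfree⟩
  obtain ⟨ε, hε⟩ := PayneGQ.exists_payneEquiv x
  -- Transport the action on the points to coordinates.
  let ψ : G →* Equiv.Perm (ZMod p × ZMod p × ZMod p) :=
    ε.symm.permCongrHom.toMonoidHom.comp
      ((MonoidHom.fst _ _).comp ((Subgroup.subtype _).comp φ))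
  have hψ : ∀ g y, ε (ψ g y) = (φ g).1.1 (ε y) := fun g y => by
    simp [ψ, Equiv.permCongrHom]
  obtain ⟨e⟩ := PayneGQ.nonempty_mulEquiv_e_of_regular hp ψ
    (fun g y z => by
      rw [← hε, ← hε, hψ, hψ]
      exact PayneGQ.Geometry.collinear_aut _ (φ g) _ _)
    (fun y => (htrans (ε 0) (ε y)).imp fun g hg => ε.injective ((hψ g 0).trans hg))
    (fun g hg => hfree g (ε 0) (by rw [← hψ, hg]))
  exact ⟨⟨e⟩, ⟨e.trans eP⟩⟩
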